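/- Let $L>0$ and let $EI:(0,L)\to\mathbb{R}$ be a measurable bending stiffness with $0<C_1\le EI(x)\le C_2$ for all $x\in(0,L)$, for some constants $C_1,C_2$. Let $$V=H^2_0(0,L)=\{v\in H^2(0,L): v(0)=v'(0)=v(L)=v'(L)=0\},\qquad a(u,v)=\int_0^L EI\,u''v''\,dx,\qquad b(u,v)=\int_0^L u'v'\,dx .$$ Let $0=x_1<x_2<\dots<x_{N+1}=L$ be a partition with elements $K_k=[x_k,x_{k+1}]$ of length $h_k=x_{k+1}-x_k$, $k=1,\dots,N$, and let $$V_h=\{v\in V: v|_{K_k}\text{ is a polynomial of degree at most }3\text{ for every }k=1,\dots,N\}$$ be the cubic Hermite finite element space. Let $\kappa_k$ be the minimum (in general, the infimum) of $EI$ over $K_k\cap(0,L)$, let $\kappa$ be the piecewise constant function with value $\kappa_k$ on $K_k$ (its values at the nodes are irrelevant), and let $\tilde a(u,v)=\int_0^L\kappa\,u''v''\,dx$. Put $$h_{EI}=\Bigl(\max_{1\le k\le N}\frac{h_k^2}{\kappa_k}\Bigr)^{1/2},\qquad C_h=\frac{h_{EI}}{2\pi}.$$ In each of the following three problems, one seeks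 real numbers (eigenvalues) for which there is a nonzero $u$ in the given space: - $a(u,v)=P\,b(u,v)$ for all $v\in V$, with $u\in V$; - $a(u,v)=P_h\,b(u,v)$ for all $v\in V_h$, with $u\in V_h$; - $\tilde a(u,v)=\widetilde P_h\,b(u,v)$ for all $v\in V_h$, with $u\in V_h$. The space $V_h$ is finite-dimensional. The eigenvalues of the first problem, each repeated according to its multiplicity, can be listed as an infinite nondecreasing sequence $P_1\le P_2\le\cdots$, and those of the second and the third problem as finite nondecreasing sequences $P_{h,i}$ and $\widetilde P_{h,i}$, $i=1,\dots,\dim V_h$. For these sequences, $$\frac{\widetilde P_{h,i}}{1+\widetilde P_{h,i}\,C_h^2}\;\le\;P_i\;\le\;P_{h,i}\qquad\text{for all } i=1,2,\dots,\dim V_h .$$ -/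

import Mathlib

open MeasureTheory Set
open scoped ContDiff

noncomputable section

namespace BeamBuckling

/-- The real Hilbert space `L²(0, L)`. -/
abbrev L2 (L : ℝ) : Type := Lp ℝ 2 (volume.restrict (Ioo 0 L))

/-! ### Weak derivatives and the space `H²₀(0, L)` -/

/-- Test functions: smooth functions with compact support contained in `(0, L)`. -/
def IsTest (L : ℝ) (φ : ℝ → ℝ) : Prop :=
  ContDiff ℝ ∞ φ ∧ HasCompactSupport φ ∧ tsupport φ ⊆ Ioo 0 L

/-- `g ∈ L²(0, L)` is the weak (distributional) derivative of `f ∈ L²(0, L)`. -/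
def IsWeakDeriv (L : ℝ) (f g : L2 L) : Prop :=
  ∀ φ : ℝ → ℝ, IsTest L φ →
    ∫ x in Ioo 0 L, f x * deriv φ x = - ∫ x in Ioo 0 L, g x * φ x

/-- The continuous representative of `f` on `[0, L]` vanishes at both end points. -/
def VanishesAtEnds (L : ℝ) (f : L2 L) : Prop :=
  ∃ w : ℝ → ℝ, ContinuousOn w (Icc 0 L) ∧ (∀ᵐ x ∂(volume.restrict (Ioo 0 L)), f x = w x) ∧
    w 0 = 0 ∧ w L = 0

theorem integrable_mul_of_bdd {L : ℝ} (f : L2 L) {φ : ℝ → ℝ} (hc : Continuous φ)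
    (hs : HasCompactSupport φ) :
    Integrable (fun x => f x * φ x) (volume.restrict (Ioo 0 L)) := by
  obtain ⟨C, hC⟩ := hs.exists_bound_of_continuous hc
  have : IsFiniteMeasure (volume.restrict (Ioo (0 : ℝ) L)) :=
    ⟨by simp [Real.volume_Ioo]⟩
  have hf : Integrable f (volume.restrict (Ioo 0 L)) := (Lp.memLp f).integrable (by norm_num)
  exact hf.mul_bdd hc.aestronglyMeasurable (Filter.Eventually.of_forall hC)

theorem IsTest.continuous_deriv {L : ℝ} {φ : ℝ → ℝ} (h : IsTest L φ) : Continuous (deriv φ) :=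
  h.1.continuous_deriv (by simp)

/-- The weak derivative is unique. -/
theorem IsWeakDeriv.unique {L : ℝ} {f g₁ g₂ : L2 L} (h₁ : IsWeakDeriv L f g₁)
    (h₂ : IsWeakDeriv L f g₂) : g₁ = g₂ := by
  have : IsFiniteMeasure (volume.restrict (Ioo (0 : ℝ) L)) :=
    ⟨by simp [Real.volume_Ioo]⟩
  have hi : ∀ g : L2 L, Integrable g (volume.restrict (Ioo 0 L)) := fun g =>
    (Lp.memLp g).integrable (by norm_num)
  have hint : IntegrableOn (fun x => g₁ x - g₂ x) (Ioo 0 L) volume := (hi g₁).sub (hi g₂)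
  have key := isOpen_Ioo.ae_eq_zero_of_integral_contDiff_smul_eq_zero (μ := volume)
    (U := Ioo (0 : ℝ) L) (f := fun x => g₁ x - g₂ x) hint.locallyIntegrableOn (by
      intro φ hφ hφc hφs
      have ht : IsTest L φ := ⟨hφ, hφc, hφs⟩
      have e : ∫ x in Ioo 0 L, g₁ x * φ x = ∫ x in Ioo 0 L, g₂ x * φ x := by
        have a := h₁ φ ht
        have b := h₂ φ ht
        linarith
      rw [← setIntegral_eq_integral_of_forall_compl_eq_zero (s := Ioo 0 L)]
      · have : ∀ x, φ x • (g₁ x - g₂ x) = g₁ x * φ x - g₂ x * φ x := fun x => by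
          simp only [smul_eq_mul]; ring
        simp_rw [this]
        rw [integral_sub (integrable_mul_of_bdd g₁ hφ.continuous hφc)
          (integrable_mul_of_bdd g₂ hφ.continuous hφc), e, sub_self]
      · intro x hx
        rw [image_eq_zero_of_notMem_tsupport (fun h => hx (hφs h)), zero_smul])
  apply Lp.ext
  rw [Filter.EventuallyEq, ae_restrict_iff' measurableSet_Ioo]
  filter_upwards [key] with x hx hm
  exact sub_eq_zero.mp (hx hm)

theorem IsWeakDeriv.add {L : ℝ} {f₁ f₂ g₁ g₂ : L2 L} (h₁ : IsWeakDeriv L f₁ g₁)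
    (h₂ : IsWeakDeriv L f₂ g₂) : IsWeakDeriv L (f₁ + f₂) (g₁ + g₂) := by
  intro φ hφ
  have e₁ : ∫ x in Ioo 0 L, (f₁ + f₂ : L2 L) x * deriv φ x =
      ∫ x in Ioo 0 L, (f₁ x * deriv φ x + f₂ x * deriv φ x) := by
    refine integral_congr_ae ?_
    filter_upwards [Lp.coeFn_add f₁ f₂] with x hx
    rw [hx, Pi.add_apply, add_mul]
  have e₂ : ∫ x in Ioo 0 L, (g₁ + g₂ : L2 L) x * φ x =
      ∫ x in Ioo 0 L, (g₁ x * φ x + g₂ x * φ x) := by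
    refine integral_congr_ae ?_
    filter_upwards [Lp.coeFn_add g₁ g₂] with x hx
    rw [hx, Pi.add_apply, add_mul]
  rw [e₁, e₂, integral_add (integrable_mul_of_bdd f₁ hφ.continuous_deriv hφ.2.1.deriv)
      (integrable_mul_of_bdd f₂ hφ.continuous_deriv hφ.2.1.deriv),
    integral_add (integrable_mul_of_bdd g₁ hφ.1.continuous hφ.2.1)
      (integrable_mul_of_bdd g₂ hφ.1.continuous hφ.2.1), h₁ φ hφ, h₂ φ hφ]
  ring

theorem IsWeakDeriv.smul {L : ℝ} (c : ℝ) {f g : L2 L} (h : IsWeakDeriv L f g) :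
    IsWeakDeriv L (c • f) (c • g) := by
  intro φ hφ
  have e₁ : ∫ x in Ioo 0 L, (c • f : L2 L) x * deriv φ x =
      ∫ x in Ioo 0 L, c * (f x * deriv φ x) := by
    refine integral_congr_ae ?_
    filter_upwards [Lp.coeFn_smul c f] with x hx
    rw [hx, Pi.smul_apply, smul_eq_mul, mul_assoc]
  have e₂ : ∫ x in Ioo 0 L, (c • g : L2 L) x * φ x = ∫ x in Ioo 0 L, c * (g x * φ x) := by
    refine integral_congr_ae ?_
    filter_upwards [Lp.coeFn_smul c g] with x hx
    rw [hx, Pi.smul_apply, smul_eq_mul, mul_assoc]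
  rw [e₁, e₂, integral_const_mul, integral_const_mul, h φ hφ]
  ring

theorem isWeakDeriv_zero (L : ℝ) : IsWeakDeriv L 0 0 := by
  have h : ∀ ψ : ℝ → ℝ, ∫ x in Ioo 0 L, (0 : L2 L) x * ψ x = 0 := by
    intro ψ
    refine integral_eq_zero_of_ae ?_
    filter_upwards [Lp.coeFn_zero ℝ 2 (volume.restrict (Ioo 0 L))] with x hx
    have hx' : (0 : L2 L) x = 0 := hx
    simp only [hx', zero_mul, Pi.zero_apply]
  intro φ _
  rw [h, h, neg_zero]

theorem VanishesAtEnds.add {L : ℝ} {f g : L2 L} (hf : VanishesAtEnds L f)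
    (hg : VanishesAtEnds L g) : VanishesAtEnds L (f + g) := by
  obtain ⟨v, hv, hfv, hv0, hvL⟩ := hf
  obtain ⟨w, hw, hgw, hw0, hwL⟩ := hg
  refine ⟨fun x => v x + w x, hv.add hw, ?_, by simp [hv0, hw0], by simp [hvL, hwL]⟩
  filter_upwards [hfv, hgw, Lp.coeFn_add f g] with x h1 h2 h3
  rw [h3, Pi.add_apply, h1, h2]

theorem VanishesAtEnds.smul {L : ℝ} (c : ℝ) {f : L2 L} (hf : VanishesAtEnds L f) :
    VanishesAtEnds L (c • f) := by
  obtain ⟨v, hv, hfv, hv0, hvL⟩ := hf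
  refine ⟨fun x => c * v x, continuousOn_const.mul hv, ?_, by simp [hv0], by simp [hvL]⟩
  filter_upwards [hfv, Lp.coeFn_smul c f] with x h1 h3
  rw [h3, Pi.smul_apply, h1, smul_eq_mul]

theorem vanishesAtEnds_zero (L : ℝ) : VanishesAtEnds L 0 :=
  ⟨fun _ => 0, continuousOn_const,
    by filter_upwards [Lp.coeFn_zero ℝ 2 (volume.restrict (Ioo 0 L))] with x hx; simpa using hx,
    rfl, rfl⟩

open Classical in
/-- The weak derivative of `f ∈ L²(0, L)` when it exists in `L²(0, L)` (and `0` otherwise). -/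
def weakDeriv (L : ℝ) (f : L2 L) : L2 L :=
  if h : ∃ g, IsWeakDeriv L f g then h.choose else 0

theorem IsWeakDeriv.weakDeriv_eq {L : ℝ} {f g : L2 L} (h : IsWeakDeriv L f g) :
    weakDeriv L f = g := by
  have hex : ∃ g, IsWeakDeriv L f g := ⟨g, h⟩
  rw [weakDeriv, dif_pos hex]
  exact hex.choose_spec.unique h

/-- `V = H²₀(0, L)`: functions in `L²(0, L)` with weak derivatives `v', v''` in `L²(0, L)` and
`v(0) = v'(0) = v(L) = v'(L) = 0`. -/
def H20 (L : ℝ) : Submodule ℝ (L2 L) where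
  carrier := {v | ∃ v₁ v₂ : L2 L, IsWeakDeriv L v v₁ ∧ IsWeakDeriv L v₁ v₂ ∧
    VanishesAtEnds L v ∧ VanishesAtEnds L v₁}
  add_mem' := by
    rintro v w ⟨v₁, v₂, h1, h2, h3, h4⟩ ⟨w₁, w₂, k1, k2, k3, k4⟩
    exact ⟨v₁ + w₁, v₂ + w₂, h1.add k1, h2.add k2, h3.add k3, h4.add k4⟩
  zero_mem' := ⟨0, 0, isWeakDeriv_zero L, isWeakDeriv_zero L, vanishesAtEnds_zero L,
    vanishesAtEnds_zero L⟩
  smul_mem' := by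
    rintro c v ⟨v₁, v₂, h1, h2, h3, h4⟩
    exact ⟨c • v₁, c • v₂, h1.smul c, h2.smul c, h3.smul c, h4.smul c⟩

/-! ### Bilinear forms and eigenvalues -/

/-- `a(u, v) = ∫₀ᴸ EI u'' v''`. -/
def formA (L : ℝ) (EI : ℝ → ℝ) (u v : L2 L) : ℝ :=
  ∫ x in Ioo 0 L, EI x * weakDeriv L (weakDeriv L u) x * weakDeriv L (weakDeriv L v) x

/-- `b(u, v) = ∫₀ᴸ u' v'`. -/
def formB (L : ℝ) (u v : L2 L) : ℝ :=
  ∫ x in Ioo 0 L, weakDeriv L u x * weakDeriv L v x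

/-- The solutions `u ∈ W` (including `0`) of `a(u, v) = P b(u, v)` for all `v ∈ W`, where
`W` is a subspace of `V`: the exact problem has `W = V`, the discrete one `W = V_h`. -/
def weakSolutions (L : ℝ) (EI : ℝ → ℝ) (W : Submodule ℝ (L2 L)) (P : ℝ) : Set (L2 L) :=
  {u | u ∈ W ∧ ∀ v ∈ W, formA L EI u v = P * formB L u v}

/-- The multiplicity of `P` as an eigenvalue: the dimension of the eigenspace (the span is there
only to have a subspace syntactically; `P` is an eigenvalue iff this is nonzero). -/
def multiplicity (L : ℝ) (EI : ℝ → ℝ) (W : Submodule ℝ (L2 L)) (P : ℝ) : Cardinal :=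
  Module.rank ℝ (Submodule.span ℝ (weakSolutions L EI W P))

/-- `P` lists all eigenvalues of the weak problem on `W` in nondecreasing order, each one
repeated according to its multiplicity. -/
def IsEigenvalueEnumeration (L : ℝ) (EI : ℝ → ℝ) (W : Submodule ℝ (L2 L)) {ι : Type} [Preorder ι]
    (P : ι → ℝ) : Prop :=
  Monotone P ∧ ∀ μ : ℝ, Cardinal.mk {i : ι // P i = μ} = multiplicity L EI W μ

/-! ### The finite element discretization -/

/-- `x` is a partition `0 = x₀ < x₁ < ⋯ < x_N = L`; its elements are
`K_k = [x k.castSucc, x k.succ]` for `k : Fin N`. -/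
structure IsPartition (L : ℝ) {N : ℕ} (x : Fin (N + 1) → ℝ) : Prop where
  strictMono : StrictMono x
  first : x 0 = 0
  last : x (Fin.last N) = L

/-- The cubic Hermite finite element space `V_h = {v ∈ V : v|_{K_k} ∈ ℙ³(K_k) for all k}`. -/
def hermiteSpace (L : ℝ) {N : ℕ} (x : Fin (N + 1) → ℝ) : Submodule ℝ (L2 L) where
  carrier := {v | v ∈ H20 L ∧ ∀ k : Fin N, ∃ p : Polynomial ℝ, p.degree ≤ 3 ∧
    ∀ᵐ t ∂(volume.restrict (Ioo 0 L)), t ∈ Icc (x k.castSucc) (x k.succ) → v t = p.eval t}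
  add_mem' := by
    rintro v w ⟨hv, hv'⟩ ⟨hw, hw'⟩
    refine ⟨add_mem hv hw, fun k => ?_⟩
    obtain ⟨p, hp, hp'⟩ := hv' k
    obtain ⟨q, hq, hq'⟩ := hw' k
    refine ⟨p + q, (Polynomial.degree_add_le p q).trans (max_le hp hq), ?_⟩
    filter_upwards [hp', hq', Lp.coeFn_add v w] with t h1 h2 h3 ht
    rw [h3, Pi.add_apply, h1 ht, h2 ht, Polynomial.eval_add]
  zero_mem' := by
    refine ⟨zero_mem _, fun k => ⟨0, by simp, ?_⟩⟩
    filter_upwards [Lp.coeFn_zero ℝ 2 (volume.restrict (Ioo 0 L))] with t h _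
    simpa using h
  smul_mem' := by
    rintro c v ⟨hv, hv'⟩
    refine ⟨Submodule.smul_mem _ c hv, fun k => ?_⟩
    obtain ⟨p, hp, hp'⟩ := hv' k
    refine ⟨c • p, (Polynomial.degree_smul_le c p).trans hp, ?_⟩
    filter_upwards [hp', Lp.coeFn_smul c v] with t h1 h3 ht
    rw [h3, Pi.smul_apply, h1 ht, Polynomial.eval_smul]

/-- `κ_k`: the minimum (in general, the infimum) of `EI` over the points of `K_k` in `(0, L)`,
where `EI` is given. -/
def elementMin (L : ℝ) (EI : ℝ → ℝ) {N : ℕ} (x : Fin (N + 1) → ℝ) (k : Fin N) : ℝ :=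
  sInf (EI '' (Icc (x k.castSucc) (x k.succ) ∩ Ioo 0 L))

/-- The piecewise constant function equal to `κ_k` on `K_k` (at a node shared by two elements,
the right one is used; this is a null set). -/
def auxStiffness (L : ℝ) (EI : ℝ → ℝ) {N : ℕ} (x : Fin (N + 1) → ℝ) (t : ℝ) : ℝ :=
  ∑ k : Fin N, (Ico (x k.castSucc) (x k.succ)).indicator (fun _ => elementMin L EI x k) t

/-- `h_EI`, where `h_EI² = max_k h_k² / κ_k` and `h_k` is the length of `K_k`. -/
def scaledMeshSize (L : ℝ) (EI : ℝ → ℝ) {N : ℕ} (x : Fin (N + 1) → ℝ) : ℝ :=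
  Real.sqrt (⨆ k : Fin N, (x k.succ - x k.castSucc) ^ 2 / elementMin L EI x k)

/-- `C_h = h_EI / (2π)`. -/
def interpConst (L : ℝ) (EI : ℝ → ℝ) {N : ℕ} (x : Fin (N + 1) → ℝ) : ℝ :=
  scaledMeshSize L EI x / (2 * Real.pi)

end BeamBuckling

end

noncomputable section

namespace BeamBuckling

/-! ### Primitives of integrable functions on an interval -/

/-! Everything is expressed through g = u''. A function lies in H²₀(0, L) exactly when it is the
double primitive of some g in L² orthogonal to the affine functions (`mem_H20_iff`). With A u = √EI
u'' and B u = u', the forms are a(u, v) = ⟪A u, A v⟫ and b(u, v) = ⟪B u, B v⟫, and B = T ∘ A, where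
T divides by √EI and integrates. T is compact (`isCompactOperator_primL`), so successive
maximization of ‖T y‖²/‖y‖² over the image of A produces a complete orthonormal system of
eigenvectors, the eigenvalues being the reciprocals of the maxima (`isEigensystem_of_isGreedy`). The
same construction serves V_h and the stiffness κ. The multiplicities determine a nondecreasing
enumeration (`eq_of_card_fibre_eq`), so it suffices to compare the constructed ones.

The upper bound is the min-max principle for V_h ⊆ V (`IsEigensystem.le_of_le`).

For the lower bound, let I u be the function whose second derivative is the L² projection of u''
onto the piecewise affine functions (`exists_interpolation`). The residual r = (u - I u)'' is
orthogonal to the affine functions on every element. This has three consequences: I u still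
satisfies the boundary conditions, hence lies in V_h; since κ is constant on elements, the energy ã
splits as ã(u) = ã(I u) + ã(u - I u); and (u - I u)' vanishes at the nodes and has mean zero on each
element, so `wirtinger`, with its constant h_k/(2π), gives ‖(u - I u)'‖ ≤ C_h ã(u - I u)^(1/2).

Now take u ≠ 0 in the span of the lowest exact eigenvectors up to index i, with I u b-orthogonal to
the discrete eigenvectors before index i. The splitting, the error bound, κ ≤ EI and a weighted
Cauchy-Schwarz inequality yield the claim (`IsEigensystem.div_le_of_projection`). -/

theorem integral_primitive_mul_deriv {a b : ℝ} {r : ℝ → ℝ}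
    (hr : IntervalIntegrable r volume a b) {φ : ℝ → ℝ} (hφ : ContDiff ℝ 1 φ) :
    ∫ x in a..b, (∫ t in a..x, r t) * deriv φ x =
      (∫ t in a..b, r t) * φ b - ∫ x in a..b, r x * φ x := by
  have h1 := hr.absolutelyContinuousOnInterval_intervalIntegral (c := a) (by simp)
  have h2 : AbsolutelyContinuousOnInterval φ a b :=
    hφ.contDiffOn.absolutelyContinuousOnInterval
  rw [h1.integral_mul_deriv_eq_deriv_mul h2]
  simp only [intervalIntegral.integral_same, zero_mul, sub_zero]
  congr 1
  refine intervalIntegral.integral_congr_ae ?_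
  filter_upwards [hr.ae_hasDerivAt_integral] with x hx hx'
  rw [(hx (uIoc_subset_uIcc hx') a (by simp)).deriv]

theorem integral_primitive {a b : ℝ} {r : ℝ → ℝ}
    (hr : IntervalIntegrable r volume a b) :
    ∫ x in a..b, (∫ t in a..x, r t) = (∫ t in a..b, r t) * b - ∫ x in a..b, r x * x := by
  have := integral_primitive_mul_deriv hr (φ := fun x => x) contDiff_id
  simpa using this

/-- Real and imaginary parts reduce this to the real integration by parts. It serves to compare the
Fourier coefficients of `r` and of its primitive, with φ' a Fourier character. -/
theorem integral_primitive_mul_complex {a b : ℝ} {r : ℝ → ℝ}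
    (hr : IntervalIntegrable r volume a b) {φ φ' : ℝ → ℂ} (hφ : ∀ x, HasDerivAt φ (φ' x) x)
    (hc : Continuous φ') :
    ∫ x in a..b, ((∫ t in a..x, r t : ℝ) : ℂ) * φ' x =
      ((∫ t in a..b, r t : ℝ) : ℂ) * φ b - ∫ x in a..b, (r x : ℂ) * φ x := by
  have hφc : Continuous φ := continuous_iff_continuousAt.2 fun x => (hφ x).continuousAt
  have hF : ContinuousOn (fun x => ∫ t in a..x, r t) (uIcc a b) :=
    (hr.absolutelyContinuousOnInterval_intervalIntegral (c := a) (by simp)).continuousOn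
  have i1 : IntervalIntegrable (fun x => ((∫ t in a..x, r t : ℝ) : ℂ) * φ' x) volume a b :=
    ((Complex.continuous_ofReal.comp_continuousOn hF).mul hc.continuousOn).intervalIntegrable
  have hrC : IntervalIntegrable (fun x => (r x : ℂ)) volume a b :=
    ⟨hr.1.ofReal, hr.2.ofReal⟩
  have i2 : IntervalIntegrable (fun x => (r x : ℂ) * φ x) volume a b :=
    hrC.mul_continuousOn hφc.continuousOn
  have dre : ∀ x, HasDerivAt (fun y => (φ y).re) (φ' x).re x := fun x =>
    (Complex.reCLM.hasFDerivAt.comp_hasDerivAt x (hφ x))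
  have dim : ∀ x, HasDerivAt (fun y => (φ y).im) (φ' x).im x := fun x =>
    (Complex.imCLM.hasFDerivAt.comp_hasDerivAt x (hφ x))
  have ere : deriv (fun y => (φ y).re) = fun x => (φ' x).re := funext fun x => (dre x).deriv
  have eim : deriv (fun y => (φ y).im) = fun x => (φ' x).im := funext fun x => (dim x).deriv
  have k1 := integral_primitive_mul_deriv hr (φ := fun y => (φ y).re)
    (contDiff_one_iff_deriv.2 ⟨fun x => (dre x).differentiableAt, by
      rw [ere]; exact Complex.continuous_re.comp hc⟩)
  have k2 := integral_primitive_mul_deriv hr (φ := fun y => (φ y).im)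
    (contDiff_one_iff_deriv.2 ⟨fun x => (dim x).differentiableAt, by
      rw [eim]; exact Complex.continuous_im.comp hc⟩)
  rw [ere] at k1
  rw [eim] at k2
  have cre : ∀ f : ℝ → ℂ, IntervalIntegrable f volume a b →
      (∫ x in a..b, f x).re = ∫ x in a..b, (f x).re := fun f hf =>
    (Complex.reCLM.intervalIntegral_comp_comm hf).symm
  have cim : ∀ f : ℝ → ℂ, IntervalIntegrable f volume a b →
      (∫ x in a..b, f x).im = ∫ x in a..b, (f x).im := fun f hf =>
    (Complex.imCLM.intervalIntegral_comp_comm hf).symm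
  apply Complex.ext
  · rw [cre _ i1, Complex.sub_re, cre _ i2]
    simpa using k1
  · rw [cim _ i1, Complex.sub_im, cim _ i2]
    simpa using k2

/-- Wirtinger's inequality for a function of mean zero vanishing at both end points. -/
theorem wirtinger {a b : ℝ} (hab : a < b) {r : ℝ → ℝ}
    (hr : MemLp r 2 (volume.restrict (Ioc a b))) (h0 : ∫ t in a..b, r t = 0)
    (h1 : ∫ x in a..b, (∫ t in a..x, r t) = 0) :
    ∫ x in a..b, (∫ t in a..x, r t) ^ 2 ≤ ((b - a) / (2 * Real.pi)) ^ 2 * ∫ x in a..b, r x ^ 2 := by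
  have hri : IntervalIntegrable r volume a b := by
    rw [intervalIntegrable_iff_integrableOn_Ioc_of_le hab.le]
    exact hr.integrable (by norm_num)
  have hF : ContinuousOn (fun x => ∫ t in a..x, r t) (uIcc a b) :=
    (hri.absolutelyContinuousOnInterval_intervalIntegral (c := a) (by simp)).continuousOn
  have hFm : MemLp (fun x => ((∫ t in a..x, r t : ℝ) : ℂ)) 2 (volume.restrict (Ioc a b)) := by
    have hc : ContinuousOn (fun x => ((∫ t in a..x, r t : ℝ) : ℂ)) (Icc a b) := by
      rw [← uIcc_of_le hab.le]; exact Complex.continuous_ofReal.comp_continuousOn hF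
    obtain ⟨C, hC⟩ := isCompact_Icc.exists_bound_of_continuousOn hc
    refine MemLp.of_bound ((hc.mono Ioc_subset_Icc_self).aestronglyMeasurable measurableSet_Ioc) C ?_
    exact (ae_restrict_iff' measurableSet_Ioc).2
      (Filter.Eventually.of_forall fun x hx => hC x (Ioc_subset_Icc_self hx))
  have hrm : MemLp (fun x => (r x : ℂ)) 2 (volume.restrict (Ioc a b)) := hr.ofReal
  -- Parseval on both sides reduces the inequality to one between squared Fourier coefficients, mode
  -- by mode.
  have s1 := hasSum_sq_fourierCoeffOn hab hFm
  have s2 := (hasSum_sq_fourierCoeffOn hab hrm).mul_left (((b - a) / (2 * Real.pi)) ^ 2)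
  have hba : 0 < b - a := sub_pos.2 hab
  have key := hasSum_le (fun n => ?_) s1 s2
  · simp only [Complex.norm_real, Real.norm_eq_abs, sq_abs, smul_eq_mul] at key
    have e := mul_le_mul_of_nonneg_left key hba.le
    rw [← mul_assoc, mul_inv_cancel₀ hba.ne', one_mul] at e
    refine e.trans (le_of_eq ?_)
    field_simp
  · have : Fact (0 < b - a) := ⟨hba⟩
    -- The mean-zero hypothesis removes the mode n = 0. For n ≠ 0, integration by parts makes the
    -- coefficient of the primitive equal, up to a unimodular factor, to (b - a)/(2π|n|) times that
    -- of `r`, and |n| ≥ 1.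
    rcases eq_or_ne n 0 with rfl | hn
    · have : fourierCoeffOn hab (fun x => ((∫ t in a..x, r t : ℝ) : ℂ)) 0 = 0 := by
        rw [fourierCoeffOn_eq_integral]
        simp only [neg_zero, fourier_zero, one_smul]
        rw [intervalIntegral.integral_ofReal, h1]
        simp
      rw [this]
      rw [norm_zero, zero_pow two_ne_zero]
      exact mul_nonneg (sq_nonneg _) (sq_nonneg _)
    · have hd := has_antideriv_at_fourier_neg ⟨hba⟩ hn
      have k := integral_primitive_mul_complex hri hd
        ((map_continuous (fourier (-n))).comp (AddCircle.continuous_mk' _))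
      have e1 : fourierCoeffOn hab (fun x => ((∫ t in a..x, r t : ℝ) : ℂ)) n =
          -(((b - a : ℝ) : ℂ) / (-2 * Real.pi * Complex.I * n)) *
            fourierCoeffOn hab (fun x => (r x : ℂ)) n := by
        rw [fourierCoeffOn_eq_integral, fourierCoeffOn_eq_integral]
        simp only [smul_eq_mul]
        have c1 : ∫ x in a..b, fourier (-n) (x : AddCircle (b - a)) * ((∫ t in a..x, r t : ℝ) : ℂ)
            = -(((b - a : ℝ) : ℂ) / (-2 * Real.pi * Complex.I * n)) *
              ∫ x in a..b, fourier (-n) (x : AddCircle (b - a)) * (r x : ℂ) := by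
          simp_rw [mul_comm (fourier (-n) _)]
          rw [k, h0, ← intervalIntegral.integral_const_mul]
          simp only [Complex.ofReal_zero, zero_mul, zero_sub, ← intervalIntegral.integral_neg]
          congr 1
          ext x
          ring
        rw [c1]
        simp only [Complex.real_smul]
        ring
      rw [e1, norm_mul, mul_pow]
      refine mul_le_mul_of_nonneg_right ?_ (by positivity)
      rw [norm_neg, norm_div]
      simp only [norm_mul, norm_neg, Complex.norm_real, Complex.norm_I, Complex.norm_ofNat,
        Complex.norm_intCast, Real.norm_eq_abs, abs_of_pos Real.pi_pos, abs_of_pos hba, mul_one]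
      refine pow_le_pow_left₀ (by positivity) ?_ 2
      refine div_le_div_of_nonneg_left hba.le (by positivity) ?_
      have : (1 : ℝ) ≤ |(n : ℝ)| := by exact_mod_cast Int.one_le_abs hn
      have hp : 0 < 2 * Real.pi := by positivity
      nlinarith

/-! ### Integration operator on `L²(0, L)` and weak derivatives -/

instance isFiniteMeasure_Ioo (L : ℝ) : IsFiniteMeasure (volume.restrict (Ioo (0 : ℝ) L)) :=
  ⟨by simp [Real.volume_Ioo]⟩

theorem restrict_Ioo_eq_Ioc (a b : ℝ) :
    (volume.restrict (Ioo a b) : Measure ℝ) = volume.restrict (Ioc a b) :=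
  Measure.restrict_congr_set Ioo_ae_eq_Ioc

theorem integral_Ioo_eq {L : ℝ} (hL : 0 ≤ L) (f : ℝ → ℝ) :
    ∫ x in Ioo 0 L, f x = ∫ x in 0..L, f x := by
  rw [restrict_Ioo_eq_Ioc, intervalIntegral.integral_of_le hL]

theorem intervalIntegrable_L2 {L : ℝ} (hL : 0 ≤ L) (g : L2 L) : IntervalIntegrable g volume 0 L := by
  rw [intervalIntegrable_iff_integrableOn_Ioc_of_le hL, IntegrableOn, ← restrict_Ioo_eq_Ioc]
  exact (Lp.memLp g).integrable (by norm_num)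

/-- The primitive vanishing at `0`. -/
def prim (g : ℝ → ℝ) (x : ℝ) : ℝ := ∫ t in (0 : ℝ)..x, g t

@[simp] theorem prim_zero (g : ℝ → ℝ) : prim g 0 = 0 := by simp [prim]

theorem continuousOn_prim {L : ℝ} (hL : 0 ≤ L) (g : L2 L) : ContinuousOn (prim g) (Icc 0 L) := by
  rw [← uIcc_of_le hL]
  exact ((intervalIntegrable_L2 hL g).absolutelyContinuousOnInterval_intervalIntegral
    (c := 0) (by simp)).continuousOn

theorem ae_uIoc_of_ae {L : ℝ} {p : ℝ → Prop} (h : ∀ᵐ x ∂(volume.restrict (Ioo 0 L)), p x) {x y : ℝ}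
    (hx : x ∈ Icc 0 L) (hy : y ∈ Icc 0 L) : ∀ᵐ t, t ∈ uIoc x y → p t := by
  rw [restrict_Ioo_eq_Ioc, ae_restrict_iff' measurableSet_Ioc] at h
  filter_upwards [h] with t ht htx
  refine ht ⟨?_, ?_⟩
  · exact (le_min hx.1 hy.1).trans_lt htx.1
  · exact htx.2.trans (max_le hx.2 hy.2)

theorem prim_congr_ae {L : ℝ} {f g : ℝ → ℝ} (h : f =ᵐ[volume.restrict (Ioo 0 L)] g)
    {x : ℝ} (hx : x ∈ Icc 0 L) : prim f x = prim g x :=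
  intervalIntegral.integral_congr_ae
    (ae_uIoc_of_ae h (left_mem_Icc.2 (hx.1.trans hx.2)) hx)

theorem intervalIntegrable_sub_interval {L : ℝ} (hL : 0 ≤ L) (g : L2 L) {x y : ℝ}
    (hx : x ∈ Icc 0 L) (hy : y ∈ Icc 0 L) : IntervalIntegrable g volume x y :=
  (intervalIntegrable_L2 hL g).mono_set (by
    rw [uIcc_of_le hL]; exact uIcc_subset_Icc hx hy)

theorem prim_add {L : ℝ} (f g : L2 L) {x : ℝ} (hx : x ∈ Icc 0 L) :
    prim (f + g : L2 L) x = prim f x + prim g x := by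
  have hL := hx.1.trans hx.2
  have h0 : (0 : ℝ) ∈ Icc 0 L := left_mem_Icc.2 hL
  rw [prim_congr_ae (Lp.coeFn_add f g) hx]
  exact intervalIntegral.integral_add (intervalIntegrable_sub_interval hL f h0 hx)
    (intervalIntegrable_sub_interval hL g h0 hx)

theorem prim_smul {L : ℝ} (c : ℝ) (f : L2 L) {x : ℝ} (hx : x ∈ Icc 0 L) :
    prim (c • f : L2 L) x = c * prim f x := by
  rw [prim_congr_ae (Lp.coeFn_smul c f) hx]
  exact intervalIntegral.integral_const_mul _ _

/-- Cauchy-Schwarz against the indicator of (0, x), whose norm is √x ≤ √L. -/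
theorem abs_prim_le {L : ℝ} (g : L2 L) {x : ℝ} (hx : x ∈ Icc 0 L) :
    |prim g x| ≤ Real.sqrt L * ‖g‖ := by
  have hL := hx.1.trans hx.2
  have hm : MeasurableSet (Ioo 0 x) := measurableSet_Ioo
  have e : prim g x = inner ℝ
      (indicatorConstLp 2 hm (measure_ne_top (volume.restrict (Ioo (0 : ℝ) L)) _) (1 : ℝ)) g := by
    rw [L2.inner_indicatorConstLp_one, Measure.restrict_restrict hm,
      inter_eq_left.2 (Ioo_subset_Ioo_right hx.2), integral_Ioo_eq hx.1]
    rfl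
  rw [e, ← Real.norm_eq_abs]
  refine (norm_inner_le_norm _ _).trans (mul_le_mul_of_nonneg_right ?_ (norm_nonneg _))
  rw [norm_indicatorConstLp (by norm_num) (by norm_num)]
  simp only [norm_one, one_mul, ENNReal.toReal_ofNat]
  rw [← Real.sqrt_eq_rpow]
  apply Real.sqrt_le_sqrt
  rw [measureReal_restrict_apply hm, inter_eq_left.2 (Ioo_subset_Ioo_right hx.2),
    Real.volume_real_Ioo_of_le hx.1]
  linarith [hx.2]

theorem memLp_prim {L : ℝ} (g : L2 L) : MemLp (prim g) 2 (volume.restrict (Ioo 0 L)) := by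
  rcases le_or_gt L 0 with h | hL
  · simp [Ioo_eq_empty (not_lt.2 h)]
  refine MemLp.of_bound (((continuousOn_prim hL.le g).mono Ioo_subset_Icc_self).aestronglyMeasurable
    measurableSet_Ioo) (Real.sqrt L * ‖g‖) ?_
  exact (ae_restrict_iff' measurableSet_Ioo).2
    (Filter.Eventually.of_forall fun x hx => abs_prim_le g (Ioo_subset_Icc_self hx))

/-- The integration operator on `L²(0, L)`. -/
def primL (L : ℝ) : L2 L →L[ℝ] L2 L :=
  LinearMap.mkContinuous
    { toFun := fun g => (memLp_prim g).toLp
      map_add' := fun f g => by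
        apply Lp.ext
        filter_upwards [(memLp_prim (f + g)).coeFn_toLp, (memLp_prim f).coeFn_toLp,
          (memLp_prim g).coeFn_toLp, Lp.coeFn_add (memLp_prim f).toLp (memLp_prim g).toLp,
          ae_restrict_mem measurableSet_Ioo] with x h1 h2 h3 h4 hx
        rw [h1, h4, Pi.add_apply, h2, h3, prim_add f g (Ioo_subset_Icc_self hx)]
      map_smul' := fun c f => by
        apply Lp.ext
        filter_upwards [(memLp_prim (c • f)).coeFn_toLp, (memLp_prim f).coeFn_toLp,
          Lp.coeFn_smul c (memLp_prim f).toLp, ae_restrict_mem measurableSet_Ioo] with x h1 h2 h4 hx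
        rw [h1, RingHom.id_apply, h4, Pi.smul_apply, h2, prim_smul c f (Ioo_subset_Icc_self hx),
          smul_eq_mul] }
    (measureUnivNNReal (volume.restrict (Ioo (0 : ℝ) L)) ^ (2 : ENNReal).toReal⁻¹ * Real.sqrt L)
    (fun g => by
      rw [mul_assoc]
      refine Lp.norm_le_of_ae_bound (by positivity) ?_
      filter_upwards [(memLp_prim g).coeFn_toLp, ae_restrict_mem measurableSet_Ioo] with x h1 hx
      simp only [LinearMap.coe_mk, AddHom.coe_mk]
      rw [h1]
      exact abs_prim_le g (Ioo_subset_Icc_self hx))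

theorem coeFn_primL {L : ℝ} (g : L2 L) :
    primL L g =ᵐ[volume.restrict (Ioo 0 L)] prim g := (memLp_prim g).coeFn_toLp

theorem prim_primL {L : ℝ} (g : L2 L) {x : ℝ} (hx : x ∈ Icc 0 L) :
    prim (primL L g) x = ∫ t in (0 : ℝ)..x, prim g t :=
  prim_congr_ae (coeFn_primL g) hx

theorem isWeakDeriv_primL {L : ℝ} (hL : 0 < L) (g : L2 L) : IsWeakDeriv L (primL L g) g := by
  intro φ hφ
  have e : ∫ x in Ioo 0 L, primL L g x * deriv φ x = ∫ x in Ioo 0 L, prim g x * deriv φ x := by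
    refine integral_congr_ae ?_
    filter_upwards [coeFn_primL g] with x hx
    rw [hx]
  have hφL : φ L = 0 := image_eq_zero_of_notMem_tsupport fun h => by simpa using hφ.2.2 h
  rw [e, integral_Ioo_eq hL.le, integral_Ioo_eq hL.le]
  have := integral_primitive_mul_deriv (intervalIntegrable_L2 hL.le g) (hφ.1.of_le (by simp))
  rw [hφL, mul_zero, zero_sub] at this
  exact this

theorem vanishesAtEnds_primL {L : ℝ} (hL : 0 < L) {g : L2 L} (hg : prim g L = 0) :
    VanishesAtEnds L (primL L g) :=
  ⟨prim g, continuousOn_prim hL.le g, coeFn_primL g, prim_zero _, hg⟩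

theorem exists_Icc_of_isCompact {L : ℝ} (hL : 0 < L) {K : Set ℝ} (hK : IsCompact K)
    (hKL : K ⊆ Ioo 0 L) : ∃ a b, 0 < a ∧ a ≤ b ∧ b < L ∧ K ⊆ Icc a b := by
  rcases K.eq_empty_or_nonempty with rfl | hne
  · exact ⟨L / 2, L / 2, by linarith, le_rfl, by linarith, empty_subset _⟩
  · have h1 := hKL (hK.sInf_mem hne)
    have h2 := hKL (hK.sSup_mem hne)
    refine ⟨sInf K, sSup K, h1.1, ?_, h2.2, fun x hx => ⟨csInf_le hK.bddBelow hx,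
      le_csSup hK.bddAbove hx⟩⟩
    obtain ⟨x, hx⟩ := hne
    exact (csInf_le hK.bddBelow hx).trans (le_csSup hK.bddAbove hx)

theorem setIntegral_of_tsupport_subset {L : ℝ} {φ : ℝ → ℝ} (h : tsupport φ ⊆ Ioo 0 L) :
    ∫ x in Ioo 0 L, φ x = ∫ x, φ x :=
  setIntegral_eq_integral_of_forall_compl_eq_zero fun _ hx =>
    image_eq_zero_of_notMem_tsupport fun h' => hx (h h')

/-- A test function of integral zero is the derivative of a test function. -/
theorem IsTest.exists_deriv_eq {L : ℝ} (hL : 0 < L) {ψ : ℝ → ℝ} (hψ : IsTest L ψ)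
    (h0 : ∫ x in Ioo 0 L, ψ x = 0) : ∃ φ, IsTest L φ ∧ deriv φ = ψ := by
  obtain ⟨a, b, ha, hab, hb, hs⟩ := exists_Icc_of_isCompact hL hψ.2.1 hψ.2.2
  have hz : ∀ x, x ∉ Icc a b → ψ x = 0 := fun x hx =>
    image_eq_zero_of_notMem_tsupport fun h => hx (hs h)
  have hd : ∀ x, HasDerivAt (prim ψ) (ψ x) x := fun x =>
    intervalIntegral.integral_hasDerivAt_right (hψ.1.continuous.intervalIntegrable _ _)
      (hψ.1.continuous.stronglyMeasurableAtFilter _ _) hψ.1.continuous.continuousAt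
  have hde : deriv (prim ψ) = ψ := funext fun x => (hd x).deriv
  -- Left of `a` the integrand vanishes; right of `b` the primitive equals the total integral, which
  -- is zero.
  have hsupp : Function.support (prim ψ) ⊆ Icc a b := by
    intro x hx
    by_contra hxn
    apply hx
    rcases lt_or_ge x a with hxa | hxa
    · refine intervalIntegral.integral_zero_ae (Filter.Eventually.of_forall fun t ht => hz t fun h => ?_)
      exact (not_lt.2 h.1) (ht.2.trans_lt (max_lt ha hxa))
    · have hxb : b < x := by
        by_contra h
        exact hxn ⟨hxa, not_lt.1 h⟩
      have e1 : ∫ t in L..x, ψ t = 0 := by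
        refine intervalIntegral.integral_zero_ae (Filter.Eventually.of_forall fun t ht => hz t fun h => ?_)
        exact (not_lt.2 h.2) ((lt_min hb hxb).trans ht.1)
      rw [integral_Ioo_eq hL.le] at h0
      have := intervalIntegral.integral_add_adjacent_intervals
        (hψ.1.continuous.intervalIntegrable (μ := volume) 0 L)
        (hψ.1.continuous.intervalIntegrable L x)
      rw [prim, ← this, h0, e1, add_zero]
  have hts : tsupport (prim ψ) ⊆ Icc a b := closure_minimal hsupp isClosed_Icc
  refine ⟨prim ψ, ⟨?_, ?_, ?_⟩, hde⟩
  · rw [contDiff_infty_iff_deriv, hde]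
    exact ⟨fun x => (hd x).differentiableAt, hψ.1⟩
  · exact isCompact_Icc.of_isClosed_subset (isClosed_tsupport _) hts
  · exact hts.trans fun x hx => ⟨ha.trans_le hx.1, hx.2.trans_lt hb⟩

theorem exists_isTest_integral_eq_one {L : ℝ} (hL : 0 < L) :
    ∃ ψ, IsTest L ψ ∧ ∫ x in Ioo 0 L, ψ x = 1 := by
  let B : ContDiffBump (L / 2 : ℝ) := ⟨L / 8, L / 4, by linarith, by linarith⟩
  have hs : tsupport (B.normed volume) ⊆ Ioo 0 L := by
    rw [B.tsupport_normed_eq, Real.closedBall_eq_Icc]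
    intro x hx
    have h1 := hx.1
    have h2 := hx.2
    simp only [B] at h1 h2
    exact ⟨by linarith, by linarith⟩
  exact ⟨B.normed volume, ⟨B.contDiff_normed, B.hasCompactSupport_normed, hs⟩, by
    rw [setIntegral_of_tsupport_subset hs, B.integral_normed]⟩

/-- A function with zero weak derivative is constant. -/
theorem IsWeakDeriv.exists_const {L : ℝ} (hL : 0 < L) {f : L2 L} (h : IsWeakDeriv L f 0) :
    ∃ c : ℝ, f =ᵐ[volume.restrict (Ioo 0 L)] fun _ => c := by
  obtain ⟨ψ, hψ, hψ1⟩ := exists_isTest_integral_eq_one hL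
  set c := ∫ x in Ioo 0 L, f x * ψ x with hc
  refine ⟨c, ?_⟩
  have hf : Integrable f (volume.restrict (Ioo 0 L)) := (Lp.memLp f).integrable (by norm_num)
  have hint : IntegrableOn (fun x => f x - c) (Ioo 0 L) volume := hf.sub (integrable_const c)
  have key := isOpen_Ioo.ae_eq_zero_of_integral_contDiff_smul_eq_zero (μ := volume)
    (U := Ioo (0 : ℝ) L) (f := fun x => f x - c) hint.locallyIntegrableOn (by
      intro φ hφ hφc hφs
      have iφ : Integrable φ (volume.restrict (Ioo 0 L)) :=
        (hφ.continuous.integrable_of_hasCompactSupport hφc).restrict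
      have iψ : Integrable ψ (volume.restrict (Ioo 0 L)) :=
        (hψ.1.continuous.integrable_of_hasCompactSupport hψ.2.1).restrict
      -- Du Bois-Reymond: φ - mψ has integral zero, so it is the derivative of a test function and
      -- `f` annihilates it. Since c = ∫ fψ, this says that f - c annihilates φ.
      set m := ∫ x in Ioo 0 L, φ x with hm
      have hsub : tsupport (fun x => φ x - m * ψ x) ⊆ tsupport φ ∪ tsupport ψ := by
        refine closure_minimal (fun x hx => ?_)
          ((isClosed_tsupport φ).union (isClosed_tsupport ψ))
        by_contra hn
        simp only [mem_union, not_or] at hn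
        apply hx
        simp [image_eq_zero_of_notMem_tsupport hn.1, image_eq_zero_of_notMem_tsupport hn.2]
      have ht : IsTest L (fun x => φ x - m * ψ x) :=
        ⟨hφ.sub (contDiff_const.mul hψ.1), (hφc.union hψ.2.1).of_isClosed_subset
          (isClosed_tsupport _) hsub, hsub.trans (union_subset hφs hψ.2.2)⟩
      obtain ⟨Φ, hΦ, hΦd⟩ := ht.exists_deriv_eq hL (by
        rw [integral_sub iφ (iψ.const_mul m), integral_const_mul, hψ1, mul_one, hm, sub_self])
      have h1 := h Φ hΦ
      have h2 : ∫ x in Ioo 0 L, (0 : L2 L) x * Φ x = 0 := by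
        refine integral_eq_zero_of_ae ?_
        filter_upwards [Lp.coeFn_zero ℝ 2 (volume.restrict (Ioo 0 L))] with x hx
        have hx' : (0 : L2 L) x = 0 := hx
        simp only [hx', zero_mul, Pi.zero_apply]
      rw [h2, neg_zero, hΦd] at h1
      have i1 := integrable_mul_of_bdd f hφ.continuous hφc
      have i2 := integrable_mul_of_bdd f hψ.1.continuous hψ.2.1
      have e1 : ∀ x, f x * (φ x - m * ψ x) = f x * φ x - m * (f x * ψ x) := fun x => by ring
      simp_rw [e1] at h1
      rw [integral_sub i1 (i2.const_mul m), integral_const_mul, ← hc] at h1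
      rw [← setIntegral_eq_integral_of_forall_compl_eq_zero (s := Ioo 0 L)]
      · have : ∀ x, φ x • (f x - c) = f x * φ x - c * φ x := fun x => by
          simp only [smul_eq_mul]; ring
        simp_rw [this]
        rw [integral_sub i1 (iφ.const_mul c), integral_const_mul, ← hm]
        linarith
      · intro x hx
        rw [image_eq_zero_of_notMem_tsupport (fun h => hx (hφs h)), zero_smul])
  rw [Filter.EventuallyEq, ae_restrict_iff' measurableSet_Ioo]
  filter_upwards [key] with x hx hm
  exact sub_eq_zero.mp (hx hm)

/-- The difference of `f` and the primitive of `g` has weak derivative zero, hence is a constant.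
Continuous representatives agree on the closed interval, so the value at 0 makes the constant vanish
and the value at `L` gives the condition on `g`. -/
theorem IsWeakDeriv.eq_primL {L : ℝ} (hL : 0 < L) {f g : L2 L} (h : IsWeakDeriv L f g)
    (hv : VanishesAtEnds L f) : f = primL L g ∧ prim g L = 0 := by
  have h1 : IsWeakDeriv L (f + (-1 : ℝ) • primL L g) 0 := by
    have := h.add ((isWeakDeriv_primL hL g).smul (-1))
    rwa [neg_one_smul, neg_one_smul, add_neg_cancel, ← neg_one_smul ℝ (primL L g)] at this
  obtain ⟨c, hc⟩ := h1.exists_const hL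
  obtain ⟨w, hw, hfw, hw0, hwL⟩ := hv
  have e : ∀ᵐ x ∂(volume.restrict (Ioo 0 L)), f x = prim g x + c := by
    filter_upwards [hc, Lp.coeFn_add f ((-1 : ℝ) • primL L g), Lp.coeFn_smul (-1 : ℝ) (primL L g),
      coeFn_primL g] with x k1 k2 k3 k4
    rw [k2, Pi.add_apply, k3, Pi.smul_apply, k4, smul_eq_mul] at k1
    linarith
  have hEq : EqOn w (fun x => prim g x + c) (Icc 0 L) := by
    refine Measure.eqOn_Icc_of_ae_eq volume hL.ne ?_ hw
      ((continuousOn_prim hL.le g).add continuousOn_const)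
    rw [← Measure.restrict_congr_set (Ioo_ae_eq_Icc (μ := volume))]
    filter_upwards [hfw, e] with x k1 k2
    rw [← k1, k2]
  have hc0 : c = 0 := by
    have := hEq (left_mem_Icc.2 hL.le)
    simpa [hw0] using this.symm
  have hgL : prim g L = 0 := by
    have := hEq (right_mem_Icc.2 hL.le)
    simpa [hwL, hc0] using this.symm
  refine ⟨Lp.ext ?_, hgL⟩
  filter_upwards [e, coeFn_primL g] with x k1 k2
  rw [k1, k2, hc0, add_zero]

theorem weakDeriv_primL {L : ℝ} (hL : 0 < L) (g : L2 L) : weakDeriv L (primL L g) = g :=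
  (isWeakDeriv_primL hL g).weakDeriv_eq

/-- Here `g` is u''. The two conditions express u'(L) = 0 and u(L) = 0; by integration by parts they
mean that `g` is orthogonal to 1 and to t. -/
theorem mem_H20_iff {L : ℝ} (hL : 0 < L) {u : L2 L} :
    u ∈ H20 L ↔ ∃ g : L2 L, prim g L = 0 ∧ prim (primL L g) L = 0 ∧ u = primL L (primL L g) := by
  constructor
  · rintro ⟨v₁, v₂, h1, h2, h3, h4⟩
    obtain ⟨e1, e2⟩ := h2.eq_primL hL h4
    obtain ⟨e3, e4⟩ := h1.eq_primL hL h3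
    subst e1
    exact ⟨v₂, e2, e4, e3⟩
  · rintro ⟨g, h1, h2, rfl⟩
    exact ⟨primL L g, g, isWeakDeriv_primL hL _, isWeakDeriv_primL hL _,
      vanishesAtEnds_primL hL h2, vanishesAtEnds_primL hL h1⟩

/-! ### Piecewise polynomials on a partition -/

theorem exists_antiderivative {d : ℕ} {p : Polynomial ℝ} (hp : p ∈ Polynomial.degreeLT ℝ d) :
    ∃ q ∈ Polynomial.degreeLT ℝ (d + 1), Polynomial.derivative q = p := by
  refine ⟨∑ i ∈ Finset.range d, Polynomial.C (p.coeff i / (i + 1)) * Polynomial.X ^ (i + 1),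
    Submodule.sum_mem _ fun i hi => ?_, ?_⟩
  · rw [Polynomial.mem_degreeLT]
    refine (Polynomial.degree_C_mul_X_pow_le _ _).trans_lt ?_
    exact_mod_cast Nat.succ_lt_succ (Finset.mem_range.1 hi)
  · rw [Polynomial.derivative_sum]
    ext n
    rw [Polynomial.finsetSum_coeff]
    have : ∀ i, (Polynomial.derivative
        (Polynomial.C (p.coeff i / (i + 1)) * Polynomial.X ^ (i + 1))).coeff n =
        if i = n then p.coeff i else 0 := by
      intro i
      have h : (i : ℝ) + 1 ≠ 0 := by positivity
      rw [Polynomial.derivative_C_mul_X_pow, Nat.add_sub_cancel, Polynomial.coeff_C_mul_X_pow]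
      push_cast
      rw [div_mul_cancel₀ _ h]
      simp only [eq_comm]
    simp_rw [this]
    rw [Finset.sum_ite_eq']
    split_ifs with h
    · rfl
    · rw [Polynomial.mem_degreeLT] at hp
      rw [Finset.mem_range, not_lt] at h
      exact (Polynomial.coeff_eq_zero_of_degree_lt (hp.trans_le (by exact_mod_cast h))).symm

namespace IsPartition

variable {L : ℝ} {N : ℕ} {x : Fin (N + 1) → ℝ}

theorem mem_Icc (hx : IsPartition L x) (i : Fin (N + 1)) : x i ∈ Icc 0 L := by
  rw [← hx.first, ← hx.last]
  exact ⟨hx.strictMono.monotone (Fin.zero_le i), hx.strictMono.monotone (Fin.le_last i)⟩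

theorem lt_succ (hx : IsPartition L x) (k : Fin N) : x k.castSucc < x k.succ :=
  hx.strictMono (Fin.castSucc_lt_succ)

theorem exists_mem_Ico (hx : IsPartition L x) {t : ℝ} (ht : t ∈ Ico 0 L) :
    ∃ k : Fin N, t ∈ Ico (x k.castSucc) (x k.succ) := by
  by_contra! h
  have : ∀ i : Fin (N + 1), x i ≤ t := by
    intro i
    induction i using Fin.induction with
    | zero => rw [hx.first]; exact ht.1
    | succ k ih => exact not_lt.1 fun h' => h k ⟨ih, h'⟩
  have h1 := this (Fin.last N)
  rw [hx.last] at h1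
  exact absurd ht.2 (not_lt.2 h1)

theorem notMem_Ico (hx : IsPartition L x) {t : ℝ} {k j : Fin N} (hjk : j ≠ k)
    (ht : t ∈ Ico (x k.castSucc) (x k.succ)) : t ∉ Ico (x j.castSucc) (x j.succ) := by
  intro h
  rcases lt_or_gt_of_ne hjk with hlt | hlt
  · have : x j.succ ≤ x k.castSucc := hx.strictMono.monotone (by
      rw [Fin.le_def]; simpa using hlt)
    linarith [h.2, ht.1]
  · have : x k.succ ≤ x j.castSucc := hx.strictMono.monotone (by
      rw [Fin.le_def]; simpa using hlt)
    linarith [h.1, ht.2]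

theorem sum_indicator (hx : IsPartition L x) (f : Fin N → ℝ → ℝ) {t : ℝ} {k : Fin N}
    (ht : t ∈ Ico (x k.castSucc) (x k.succ)) :
    ∑ j : Fin N, (Ico (x j.castSucc) (x j.succ)).indicator (f j) t = f k t := by
  rw [Finset.sum_eq_single k, indicator_of_mem ht]
  · intro j _ hj
    exact indicator_of_notMem (hx.notMem_Ico hj ht) _
  · simp

theorem sum_integral (hx : IsPartition L x) {f : ℝ → ℝ} (hf : IntervalIntegrable f volume 0 L) :
    ∑ k : Fin N, ∫ t in x k.castSucc..x k.succ, f t = ∫ t in 0..L, f t := by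
  have h0 : (0 : ℝ) ≤ L := (hx.mem_Icc 0).1.trans (hx.mem_Icc 0).2
  -- Induction over the nodes: the elements to the left of node `i` add up to the integral from 0 to
  -- that node.
  have key : ∀ i : Fin (N + 1),
      ∑ k ∈ Finset.univ.filter (fun k : Fin N => k.castSucc < i),
        ∫ t in x k.castSucc..x k.succ, f t = ∫ t in 0..x i, f t := by
    have hint : ∀ i j, IntervalIntegrable f volume (x i) (x j) := fun i j => hf.mono_set (by
      rw [uIcc_of_le h0]; exact uIcc_subset_Icc (hx.mem_Icc i) (hx.mem_Icc j))
    intro i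
    induction i using Fin.induction with
    | zero => simp [hx.first]
    | succ k ih =>
      have : Finset.univ.filter (fun j : Fin N => j.castSucc < k.succ) =
          insert k (Finset.univ.filter (fun j : Fin N => j.castSucc < k.castSucc)) := by
        ext j
        simp only [Finset.mem_filter, Finset.mem_univ, true_and, Finset.mem_insert,
          Fin.lt_def, Fin.val_castSucc, Fin.val_succ, Fin.ext_iff]
        omega
      rw [this, Finset.sum_insert (by simp), ih, add_comm]
      have h1 := hint 0 k.castSucc
      rw [hx.first] at h1
      exact intervalIntegral.integral_add_adjacent_intervals h1 (hint _ _)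
  have := key (Fin.last N)
  rw [hx.last] at this
  rw [← this]
  congr 1
  ext k
  simp [Fin.castSucc_lt_last]

end IsPartition

/-- Piecewise polynomials of degree less than `d` in `L²(0, L)`. -/
def piecewisePoly (L : ℝ) {N : ℕ} (x : Fin (N + 1) → ℝ) (d : ℕ) : Submodule ℝ (L2 L) where
  carrier := {v | ∀ k : Fin N, ∃ p ∈ Polynomial.degreeLT ℝ d,
    ∀ᵐ t ∂(volume.restrict (Ioo 0 L)), t ∈ Icc (x k.castSucc) (x k.succ) → v t = p.eval t}
  add_mem' := by
    rintro v w hv hw k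
    obtain ⟨p, hp, hp'⟩ := hv k
    obtain ⟨q, hq, hq'⟩ := hw k
    refine ⟨p + q, add_mem hp hq, ?_⟩
    filter_upwards [hp', hq', Lp.coeFn_add v w] with t h1 h2 h3 ht
    rw [h3, Pi.add_apply, h1 ht, h2 ht, Polynomial.eval_add]
  zero_mem' := fun k => ⟨0, zero_mem _, by
    filter_upwards [Lp.coeFn_zero ℝ 2 (volume.restrict (Ioo 0 L))] with t h _
    simpa using h⟩
  smul_mem' := by
    rintro c v hv k
    obtain ⟨p, hp, hp'⟩ := hv k
    refine ⟨c • p, Submodule.smul_mem _ c hp, ?_⟩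
    filter_upwards [hp', Lp.coeFn_smul c v] with t h1 h3 ht
    rw [h3, Pi.smul_apply, h1 ht, Polynomial.eval_smul]

theorem memLp_indicator_poly (L a b : ℝ) (p : Polynomial ℝ) :
    MemLp ((Ico a b).indicator fun t => p.eval t) 2 (volume.restrict (Ioo 0 L)) := by
  obtain ⟨C, hC⟩ := (isCompact_Icc (a := a) (b := b)).exists_bound_of_continuousOn
    p.continuous.continuousOn
  refine MemLp.of_bound (p.continuous.aestronglyMeasurable.indicator measurableSet_Ico) (max C 0)
    (Filter.Eventually.of_forall fun t => ?_)
  by_cases ht : t ∈ Ico a b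
  · rw [indicator_of_mem ht]
    exact (hC t (Ico_subset_Icc_self ht)).trans (le_max_left _ _)
  · rw [indicator_of_notMem ht, norm_zero]
    exact le_max_right _ _

/-- The polynomial `p` on `[a, b)`, extended by zero. -/
def polyOn (L a b : ℝ) : Polynomial ℝ →ₗ[ℝ] L2 L where
  toFun p := (memLp_indicator_poly L a b p).toLp
  map_add' p q := by
    apply Lp.ext
    filter_upwards [(memLp_indicator_poly L a b (p + q)).coeFn_toLp,
      (memLp_indicator_poly L a b p).coeFn_toLp, (memLp_indicator_poly L a b q).coeFn_toLp,
      Lp.coeFn_add (memLp_indicator_poly L a b p).toLp (memLp_indicator_poly L a b q).toLp]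
      with t h1 h2 h3 h4
    rw [h1, h4, Pi.add_apply, h2, h3]
    by_cases ht : t ∈ Ico a b <;> simp [ht]
  map_smul' c p := by
    apply Lp.ext
    filter_upwards [(memLp_indicator_poly L a b (c • p)).coeFn_toLp,
      (memLp_indicator_poly L a b p).coeFn_toLp,
      Lp.coeFn_smul c (memLp_indicator_poly L a b p).toLp] with t h1 h2 h4
    rw [h1, RingHom.id_apply, h4, Pi.smul_apply, h2]
    by_cases ht : t ∈ Ico a b <;> simp [ht]

theorem coeFn_polyOn (L a b : ℝ) (p : Polynomial ℝ) :
    polyOn L a b p =ᵐ[volume.restrict (Ioo 0 L)] (Ico a b).indicator fun t => p.eval t :=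
  (memLp_indicator_poly L a b p).coeFn_toLp

section

variable {L : ℝ} {N : ℕ} {x : Fin (N + 1) → ℝ}

theorem finiteDimensional_piecewisePoly (hx : IsPartition L x) (d : ℕ) :
    FiniteDimensional ℝ (piecewisePoly L x d) := by
  have : FiniteDimensional ℝ (Polynomial.degreeLT ℝ d) :=
    Module.Finite.equiv (Polynomial.degreeLTEquiv ℝ d).symm
  let Φ : (Fin N → Polynomial.degreeLT ℝ d) →ₗ[ℝ] L2 L :=
    ∑ k : Fin N, (polyOn L (x k.castSucc) (x k.succ)) ∘ₗ (Submodule.subtype _) ∘ₗ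
      (LinearMap.proj k)
  have hle : piecewisePoly L x d ≤ LinearMap.range Φ := by
    intro v hv
    choose p hp hpv using hv
    let P : Fin N → Polynomial.degreeLT ℝ d := fun k => ⟨p k, hp k⟩
    refine LinearMap.mem_range.2 ⟨P, Lp.ext ?_⟩
    have e : Φ P = ∑ k : Fin N, polyOn L (x k.castSucc) (x k.succ) (p k) := by
      simp [Φ, P]
    rw [e]
    have h1 : ∀ᵐ t ∂(volume.restrict (Ioo 0 L)), ∀ k, polyOn L (x k.castSucc) (x k.succ) (p k) t =
        (Ico (x k.castSucc) (x k.succ)).indicator (fun t => (p k).eval t) t :=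
      ae_all_iff.2 fun k => coeFn_polyOn _ _ _ _
    filter_upwards [Lp.coeFn_finsetSum Finset.univ
      (fun k => polyOn L (x k.castSucc) (x k.succ) (p k)), h1, ae_all_iff.2 hpv,
      ae_restrict_mem measurableSet_Ioo] with t h2 h3 h4 h5
    obtain ⟨k, hk⟩ := hx.exists_mem_Ico (Ioo_subset_Ico_self h5)
    rw [h2, Finset.sum_apply, h4 k (Ico_subset_Icc_self hk)]
    simp_rw [h3]
    exact hx.sum_indicator (fun k t => (p k).eval t) hk
  exact Submodule.finiteDimensional_of_le hle

/-- The strict bound `degreeLT ℝ 4` is used because it is a submodule and integration raises the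
index by exactly one: two primitives lead from piecewise affine (index 2) to piecewise cubic. -/
theorem mem_hermiteSpace_iff {v : L2 L} :
    v ∈ hermiteSpace L x ↔ v ∈ H20 L ∧ v ∈ piecewisePoly L x 4 := by
  have h : ∀ p : Polynomial ℝ, p.degree ≤ 3 ↔ p ∈ Polynomial.degreeLT ℝ 4 := fun p => by
    rw [Polynomial.mem_degreeLT]
    exact Order.lt_succ_iff (b := (3 : WithBot ℕ)).symm
  change (_ ∧ ∀ k : Fin N, ∃ p : Polynomial ℝ, p.degree ≤ 3 ∧ _) ↔
    (_ ∧ ∀ k : Fin N, ∃ p : Polynomial ℝ, p ∈ Polynomial.degreeLT ℝ 4 ∧ _)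
  simp only [h]

theorem finiteDimensional_hermiteSpace (hx : IsPartition L x) :
    FiniteDimensional ℝ (hermiteSpace L x) :=
  have := finiteDimensional_piecewisePoly hx 4
  Submodule.finiteDimensional_of_le (S₂ := piecewisePoly L x 4)
    fun _ hv => (mem_hermiteSpace_iff.1 hv).2

theorem polyOn_mem_piecewisePoly (hx : IsPartition L x) {d : ℕ} (k : Fin N) {p : Polynomial ℝ}
    (hp : p ∈ Polynomial.degreeLT ℝ d) :
    polyOn L (x k.castSucc) (x k.succ) p ∈ piecewisePoly L x d := by
  intro j
  -- `piecewisePoly` refers to closed elements and `polyOn` to half-open ones; they differ only at a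
  -- node, a null set.
  have hne : ∀ᵐ t ∂(volume.restrict (Ioo 0 L)), t ≠ x j.succ :=
    ae_restrict_of_ae (Measure.ae_ne volume _)
  rcases eq_or_ne j k with rfl | hjk
  · refine ⟨p, hp, ?_⟩
    filter_upwards [coeFn_polyOn L (x j.castSucc) (x j.succ) p, hne] with t h1 h2 h3
    rw [h1, indicator_of_mem (show t ∈ Ico _ _ from ⟨h3.1, lt_of_le_of_ne h3.2 h2⟩)]
  · refine ⟨0, zero_mem _, ?_⟩
    filter_upwards [coeFn_polyOn L (x k.castSucc) (x k.succ) p, hne] with t h1 h2 h3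
    rw [h1, indicator_of_notMem (hx.notMem_Ico hjk.symm ⟨h3.1, lt_of_le_of_ne h3.2 h2⟩),
      Polynomial.eval_zero]

theorem prim_eq_add {g : L2 L} {s t : ℝ} (hs : s ∈ Icc 0 L) (ht : t ∈ Icc 0 L) :
    prim g t = prim g s + ∫ r in s..t, g r := by
  have hL := hs.1.trans hs.2
  have h0 : (0 : ℝ) ∈ Icc 0 L := left_mem_Icc.2 hL
  exact (intervalIntegral.integral_add_adjacent_intervals
    (intervalIntegrable_sub_interval hL g h0 hs) (intervalIntegrable_sub_interval hL g hs ht)).symm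

theorem primL_mem_piecewisePoly (hx : IsPartition L x) {d : ℕ} {q : L2 L}
    (hq : q ∈ piecewisePoly L x d) : primL L q ∈ piecewisePoly L x (d + 1) := by
  intro k
  obtain ⟨p, hp, hpq⟩ := hq k
  obtain ⟨P, hP, hPd⟩ := exists_antiderivative hp
  -- The constant makes the polynomial agree with the primitive of `q` at the left node of the
  -- element.
  refine ⟨P + Polynomial.C (prim q (x k.castSucc) - P.eval (x k.castSucc)), add_mem hP ?_, ?_⟩
  · rw [Polynomial.mem_degreeLT]
    exact Polynomial.degree_C_le.trans_lt (by exact_mod_cast Nat.succ_pos d)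
  · filter_upwards [coeFn_primL q, ae_restrict_mem measurableSet_Ioo] with t h1 h2 h3
    have hs := hx.mem_Icc k.castSucc
    have ht := Ioo_subset_Icc_self h2
    rw [h1, prim_eq_add hs ht, Polynomial.eval_add, Polynomial.eval_C]
    have e1 : ∫ r in x k.castSucc..t, q r = ∫ r in x k.castSucc..t, p.eval r := by
      refine intervalIntegral.integral_congr_ae ?_
      filter_upwards [ae_uIoc_of_ae hpq hs ht] with r hr hrm
      refine hr hrm ?_
      rw [uIoc_of_le h3.1] at hrm
      exact ⟨hrm.1.le, hrm.2.trans h3.2⟩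
    have e2 : ∫ r in x k.castSucc..t, p.eval r = P.eval t - P.eval (x k.castSucc) := by
      rw [← hPd]
      exact intervalIntegral.integral_eq_sub_of_hasDerivAt (fun r _ => P.hasDerivAt r)
        ((Polynomial.derivative P).continuous.intervalIntegrable _ _)
    rw [e1, e2]
    ring

/-! ### The interpolation error -/

theorem intervalIntegrable_mul {f g : ℝ → ℝ} {a b : ℝ} (ha : a ∈ Icc 0 L) (hb : b ∈ Icc 0 L)
    (hf : MemLp f 2 (volume.restrict (Ioo 0 L))) (hg : MemLp g 2 (volume.restrict (Ioo 0 L))) :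
    IntervalIntegrable (fun t => f t * g t) volume a b := by
  have h : IntervalIntegrable (fun t => f t * g t) volume 0 L := by
    rw [intervalIntegrable_iff_integrableOn_Ioc_of_le (ha.1.trans ha.2), IntegrableOn,
      ← restrict_Ioo_eq_Ioc]
    exact MemLp.integrable_mul hf hg
  refine h.mono_set ?_
  rw [uIcc_of_le (ha.1.trans ha.2)]
  exact uIcc_subset_Icc ha hb

theorem intervalIntegrable_sq {f : ℝ → ℝ} {a b : ℝ} (ha : a ∈ Icc 0 L) (hb : b ∈ Icc 0 L)
    (hf : MemLp f 2 (volume.restrict (Ioo 0 L))) :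
    IntervalIntegrable (fun t => f t ^ 2) volume a b := by
  simp_rw [sq]
  exact intervalIntegrable_mul ha hb hf hf

/-- `r` is orthogonal to the affine functions on each element. -/
def OrthAffine (x : Fin (N + 1) → ℝ) (r : L2 L) : Prop :=
  ∀ k : Fin N, ∫ t in x k.castSucc..x k.succ, r t = 0 ∧ ∫ t in x k.castSucc..x k.succ, r t * t = 0

/-- No continuity is imposed on piecewise affine functions, so 1 and t, cut off to a single element,
are admissible test functions. -/
theorem orthAffine_of_mem_orthogonal (hx : IsPartition L x) {r : L2 L}
    (hr : r ∈ (piecewisePoly L x 2)ᗮ) : OrthAffine x r := by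
  have key : ∀ (k : Fin N) (p : Polynomial ℝ), p ∈ Polynomial.degreeLT ℝ 2 →
      ∫ t in x k.castSucc..x k.succ, r t * p.eval t = 0 := by
    intro k p hp
    have h := hr _ (polyOn_mem_piecewisePoly hx k hp)
    rw [L2.inner_def] at h
    refine Eq.trans ?_ h
    rw [intervalIntegral.integral_of_le (hx.lt_succ k).le]
    have e : ∫ t in Ioo 0 L, inner ℝ (polyOn L (x k.castSucc) (x k.succ) p t) (r t) =
        ∫ t in Ioo 0 L, (Ico (x k.castSucc) (x k.succ)).indicator (fun t => r t * p.eval t) t := by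
      refine integral_congr_ae ?_
      filter_upwards [coeFn_polyOn L (x k.castSucc) (x k.succ) p] with t ht
      rw [ht]
      by_cases htk : t ∈ Ico (x k.castSucc) (x k.succ) <;> simp [htk]
    rw [e, ← restrict_Ioo_eq_Ioc,
      setIntegral_congr_set (Ioo_ae_eq_Ico (a := (0 : ℝ)) (b := L)),
      setIntegral_indicator measurableSet_Ico,
      inter_eq_right.2 (Ico_subset_Ico (hx.mem_Icc _).1 (hx.mem_Icc _).2),
      setIntegral_congr_set (Ioo_ae_eq_Ico (a := x k.castSucc) (b := x k.succ))]
  intro k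
  constructor
  · have := key k 1 (by
      rw [Polynomial.mem_degreeLT, Polynomial.degree_one]; norm_num)
    simpa using this
  · have := key k Polynomial.X (by
      rw [Polynomial.mem_degreeLT, Polynomial.degree_X]; norm_num)
    simpa using this

namespace OrthAffine

variable {r : L2 L}

theorem prim_eq_zero (hx : IsPartition L x) (hr : OrthAffine x r) (i : Fin (N + 1)) :
    prim r (x i) = 0 := by
  induction i using Fin.induction with
  | zero => rw [hx.first, prim_zero]
  | succ k ih => rw [prim_eq_add (hx.mem_Icc k.castSucc) (hx.mem_Icc k.succ), ih, (hr k).1, add_zero]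

theorem prim_eq (hx : IsPartition L x) (hr : OrthAffine x r) (k : Fin N) {t : ℝ}
    (ht : t ∈ Icc 0 L) : prim r t = ∫ s in x k.castSucc..t, r s := by
  rw [prim_eq_add (hx.mem_Icc k.castSucc) ht, hr.prim_eq_zero hx, zero_add]

theorem mem_Icc_of_mem_uIcc (hx : IsPartition L x) {k : Fin N} {t : ℝ}
    (ht : t ∈ uIcc (x k.castSucc) (x k.succ)) : t ∈ Icc 0 L :=
  uIcc_subset_Icc (hx.mem_Icc _) (hx.mem_Icc _) ht

/-- Integration by parts turns the mean of the primitive into the moments of `r` against 1 and t.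
This is the mean-zero hypothesis needed for `wirtinger`. -/
theorem integral_prim_eq_zero (hx : IsPartition L x) (hr : OrthAffine x r) (k : Fin N) :
    ∫ t in x k.castSucc..x k.succ, (∫ s in x k.castSucc..t, r s) = 0 := by
  have hL := (hx.mem_Icc 0).1.trans (hx.mem_Icc 0).2
  rw [integral_primitive (intervalIntegrable_sub_interval hL r (hx.mem_Icc _) (hx.mem_Icc _)),
    (hr k).1, (hr k).2]
  simp

theorem prim_primL_eq_zero (hx : IsPartition L x) (hr : OrthAffine x r) :
    prim (primL L r) L = 0 := by
  have hL := (hx.mem_Icc 0).1.trans (hx.mem_Icc 0).2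
  rw [prim_primL r (right_mem_Icc.2 hL), ← hx.sum_integral (by
    have := continuousOn_prim hL r
    rw [← uIcc_of_le hL] at this
    exact this.intervalIntegrable)]
  refine Finset.sum_eq_zero fun k _ => ?_
  refine Eq.trans ?_ (hr.integral_prim_eq_zero hx k)
  exact intervalIntegral.integral_congr fun t ht => hr.prim_eq hx k (mem_Icc_of_mem_uIcc hx ht)

/-- On each element the primitive vanishes at both ends and has mean zero, so `wirtinger` applies
there. The weights `c` are the κ_k in the interpolation estimate, and 1 in the compactness proof. -/
theorem integral_sq_prim_le (hx : IsPartition L x) (hr : OrthAffine x r) {C : ℝ} {c : Fin N → ℝ}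
    (hC : ∀ k, ((x k.succ - x k.castSucc) / (2 * Real.pi)) ^ 2 ≤ C * c k) :
    ∫ t in 0..L, prim r t ^ 2 ≤ C * ∑ k : Fin N, c k * ∫ t in x k.castSucc..x k.succ, r t ^ 2 := by
  have hL := (hx.mem_Icc 0).1.trans (hx.mem_Icc 0).2
  rw [← hx.sum_integral (intervalIntegrable_sq (left_mem_Icc.2 hL) (right_mem_Icc.2 hL)
    (memLp_prim r)), Finset.mul_sum]
  refine Finset.sum_le_sum fun k _ => ?_
  have hlt := hx.lt_succ k
  have hm : MemLp r 2 (volume.restrict (Ioc (x k.castSucc) (x k.succ))) := by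
    have h : MemLp r 2 (volume.restrict (Ioc 0 L)) := by
      rw [← restrict_Ioo_eq_Ioc]; exact Lp.memLp r
    exact h.mono_measure (Measure.restrict_mono
      (Ioc_subset_Ioc (hx.mem_Icc _).1 (hx.mem_Icc _).2) le_rfl)
  have hw := wirtinger hlt hm (hr k).1 (hr.integral_prim_eq_zero hx k)
  have e : ∫ t in x k.castSucc..x k.succ, prim r t ^ 2 =
      ∫ t in x k.castSucc..x k.succ, (∫ s in x k.castSucc..t, r s) ^ 2 :=
    intervalIntegral.integral_congr fun t ht => by
      simp only [hr.prim_eq hx k (mem_Icc_of_mem_uIcc hx ht)]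
  rw [e, ← mul_assoc]
  refine hw.trans (mul_le_mul_of_nonneg_right (hC k) ?_)
  exact intervalIntegral.integral_nonneg hlt.le fun t _ => sq_nonneg _

/-- Orthogonality holds on every element separately and therefore survives the weights κ_k; this
makes an unweighted L² projection orthogonal for ã as well. -/
theorem integral_mul_eq_zero (hx : IsPartition L x) (hr : OrthAffine x r) {q : L2 L}
    (hq : q ∈ piecewisePoly L x 2) (k : Fin N) :
    ∫ t in x k.castSucc..x k.succ, q t * r t = 0 := by
  have hL := (hx.mem_Icc 0).1.trans (hx.mem_Icc 0).2
  obtain ⟨p, hp, hpq⟩ := hq k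
  have hdeg : p.natDegree ≤ 1 := by
    rw [Polynomial.mem_degreeLT] at hp
    exact Polynomial.natDegree_le_of_degree_le (Order.lt_succ_iff (b := (1 : WithBot ℕ)).1 hp)
  obtain ⟨a, b, hab⟩ := Polynomial.exists_eq_X_add_C_of_natDegree_le_one hdeg
  have e : ∫ t in x k.castSucc..x k.succ, q t * r t =
      ∫ t in x k.castSucc..x k.succ, (a * (r t * t) + b * r t) := by
    refine intervalIntegral.integral_congr_ae ?_
    filter_upwards [ae_uIoc_of_ae hpq (hx.mem_Icc k.castSucc) (hx.mem_Icc k.succ)] with t ht htm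
    rw [ht htm (by
      rw [uIoc_of_le (hx.lt_succ k).le] at htm
      exact Ioc_subset_Icc_self htm), hab]
    simp only [Polynomial.eval_add, Polynomial.eval_mul, Polynomial.eval_C, Polynomial.eval_X]
    ring
  have i1 := intervalIntegrable_sub_interval hL r (hx.mem_Icc k.castSucc) (hx.mem_Icc k.succ)
  rw [e, intervalIntegral.integral_add ((i1.mul_continuousOn continuous_id'.continuousOn).const_mul a)
    (i1.const_mul b), intervalIntegral.integral_const_mul, intervalIntegral.integral_const_mul,
    (hr k).1, (hr k).2]
  simp

end OrthAffine

end

/-! ### Compactness of the integration operator -/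

theorem inner_eq_integral {L : ℝ} (hL : 0 ≤ L) (f g : L2 L) :
    inner ℝ f g = ∫ t in 0..L, f t * g t := by
  rw [L2.inner_def, integral_Ioo_eq hL]
  simp [mul_comm]

theorem norm_sq_eq_integral {L : ℝ} (hL : 0 ≤ L) (g : L2 L) :
    ‖g‖ ^ 2 = ∫ t in 0..L, g t ^ 2 := by
  rw [← real_inner_self_eq_norm_sq, inner_eq_integral hL]
  simp_rw [sq]

theorem norm_sq_primL {L : ℝ} (hL : 0 ≤ L) (g : L2 L) :
    ‖primL L g‖ ^ 2 = ∫ t in 0..L, prim g t ^ 2 := by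
  rw [norm_sq_eq_integral hL, ← integral_Ioo_eq hL, ← integral_Ioo_eq hL]
  refine integral_congr_ae ?_
  filter_upwards [coeFn_primL g] with t ht
  rw [ht]

/-- The uniform partition with `n + 1` elements. -/
def uniformPartition (L : ℝ) (n : ℕ) (i : Fin (n + 1 + 1)) : ℝ := L / (n + 1) * (i : ℕ)

theorem isPartition_uniform {L : ℝ} (hL : 0 < L) (n : ℕ) : IsPartition L (uniformPartition L n) where
  strictMono i j hij := by
    have : ((i : ℕ) : ℝ) < (j : ℕ) := by exact_mod_cast hij
    exact mul_lt_mul_of_pos_left this (by positivity)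
  first := by simp [uniformPartition]
  last := by
    have : (n : ℝ) + 1 ≠ 0 := by positivity
    simp [uniformPartition]
    field_simp

theorem uniformPartition_sub (L : ℝ) (n : ℕ) (k : Fin (n + 1)) :
    uniformPartition L n k.succ - uniformPartition L n k.castSucc = L / (n + 1) := by
  simp [uniformPartition]
  ring

theorem norm_primL_le_of_orthAffine {L : ℝ} (hL : 0 < L) (n : ℕ) {r : L2 L}
    (hr : OrthAffine (uniformPartition L n) r) :
    ‖primL L r‖ ≤ L / (n + 1) / (2 * Real.pi) * ‖r‖ := by
  have hx := isPartition_uniform hL n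
  have h := hr.integral_sq_prim_le hx (C := (L / (n + 1) / (2 * Real.pi)) ^ 2) (c := fun _ => 1)
    (fun k => by rw [uniformPartition_sub, mul_one])
  simp_rw [one_mul] at h
  rw [hx.sum_integral (intervalIntegrable_sq (left_mem_Icc.2 hL.le) (right_mem_Icc.2 hL.le)
    (Lp.memLp r)), ← norm_sq_primL hL.le, ← norm_sq_eq_integral hL.le, ← mul_pow] at h
  exact (sq_le_sq₀ (norm_nonneg _) (by positivity)).1 h

/-- Projecting first onto piecewise affine functions on a uniform mesh gives finite-rank operators;
by the Wirtinger estimate they converge in operator norm, with error at most L/(2π(n + 1)). -/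
theorem isCompactOperator_primL {L : ℝ} (hL : 0 < L) : IsCompactOperator (primL L) := by
  have hfin : ∀ n : ℕ, FiniteDimensional ℝ (piecewisePoly L (uniformPartition L n) 2) := fun n =>
    finiteDimensional_piecewisePoly (isPartition_uniform hL n) 2
  let S : ℕ → (L2 L →L[ℝ] L2 L) := fun n =>
    primL L ∘L (piecewisePoly L (uniformPartition L n) 2).starProjection
  have hS : ∀ n, IsCompactOperator (S n) := by
    intro n
    have h1 : IsCompactOperator (piecewisePoly L (uniformPartition L n) 2).orthogonalProjectionOnto := by
      have : ProperSpace (piecewisePoly L (uniformPartition L n) 2) := FiniteDimensional.proper ℝ _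
      exact isCompactOperator_of_locallyCompactSpace_dom _
    exact h1.clm_comp (primL L ∘L (piecewisePoly L (uniformPartition L n) 2).subtypeL)
  refine isCompactOperator_of_tendsto (l := Filter.atTop) (F := S) ?_ (Filter.Eventually.of_forall hS)
  rw [tendsto_iff_norm_sub_tendsto_zero]
  have hlim : Filter.Tendsto (fun n : ℕ => L / (2 * Real.pi) * (1 / ((n : ℝ) + 1))) Filter.atTop
      (nhds 0) := by
    simpa using (tendsto_one_div_add_atTop_nhds_zero_nat (𝕜 := ℝ)).const_mul (L / (2 * Real.pi))
  refine squeeze_zero (fun n => norm_nonneg _) (fun n => ?_) hlim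
  refine ContinuousLinearMap.opNorm_le_bound _ (by positivity) fun g => ?_
  set r : L2 L := g - (piecewisePoly L (uniformPartition L n) 2).starProjection g with hr
  have e : (S n - primL L) g = - primL L r := by
    simp [S, hr, map_sub]
  have ho := orthAffine_of_mem_orthogonal (isPartition_uniform hL n)
    (Submodule.sub_starProjection_mem_orthogonal (K := piecewisePoly L (uniformPartition L n) 2) g)
  have hle : ‖r‖ ≤ ‖g‖ := by
    have h := Submodule.norm_sq_eq_add_norm_sq_starProjection g
      (piecewisePoly L (uniformPartition L n) 2)
    rw [Submodule.starProjection_orthogonal_val] at h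
    refine (sq_le_sq₀ (norm_nonneg _) (norm_nonneg _)).1 ?_
    rw [h]
    exact le_add_of_nonneg_left (sq_nonneg _)
  rw [e, norm_neg]
  calc ‖primL L r‖ ≤ L / (n + 1) / (2 * Real.pi) * ‖r‖ := norm_primL_le_of_orthAffine hL n ho
    _ ≤ L / (n + 1) / (2 * Real.pi) * ‖g‖ := by gcongr
    _ = L / (2 * Real.pi) * (1 / ((n : ℝ) + 1)) * ‖g‖ := by field_simp

/-! ### Enumerations with prescribed multiplicities -/

/-- Matching fibres gives a permutation f with Q ∘ f = P. If P i < Q i, monotonicity forces f to map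
the finite set of indices ≤ i injectively into those < i, which is impossible. -/
theorem eq_of_card_fibre_eq {ι : Type} [LinearOrder ι] [LocallyFiniteOrderBot ι] {P Q : ι → ℝ}
    (hP : Monotone P) (hQ : Monotone Q)
    (h : ∀ μ : ℝ, Cardinal.mk {i // P i = μ} = Cardinal.mk {i // Q i = μ}) : P = Q := by
  have aux : ∀ P Q : ι → ℝ, Monotone Q →
      (∀ μ : ℝ, Cardinal.mk {i // P i = μ} = Cardinal.mk {i // Q i = μ}) → Monotone P →
      ∀ i, Q i ≤ P i := by
    intro P Q hQ h hP i
    by_contra! hlt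
    let ε : ∀ μ : ℝ, {i // P i = μ} ≃ {i // Q i = μ} := fun μ =>
      Classical.choice (Cardinal.eq.1 (h μ))
    let f : ι ≃ ι := (Equiv.sigmaFiberEquiv P).symm.trans
      ((Equiv.sigmaCongrRight ε).trans (Equiv.sigmaFiberEquiv Q))
    have hf : ∀ j, Q (f j) = P j := fun j => (ε (P j) ⟨j, rfl⟩).2
    have hmaps : ∀ j ∈ Finset.Iic i, f j ∈ Finset.Iio i := by
      intro j hj
      rw [Finset.mem_Iic] at hj
      rw [Finset.mem_Iio]
      by_contra! hn
      have h1 := hQ hn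
      rw [hf] at h1
      linarith [hP hj]
    have hcard := Finset.card_le_card_of_injOn f hmaps f.injective.injOn
    have hss : Finset.Iio i ⊂ Finset.Iic i := by
      rw [Finset.ssubset_iff_of_subset (fun j hj => by
        rw [Finset.mem_Iio] at hj; exact Finset.mem_Iic.2 hj.le)]
      exact ⟨i, Finset.mem_Iic.2 le_rfl, by simp⟩
    exact absurd (Finset.card_lt_card hss) (not_lt.2 hcard)
  funext i
  exact le_antisymm (aux Q P hP (fun μ => (h μ).symm) hQ i) (aux P Q hQ h hP i)

/-! ### Successive maximization for a compact operator -/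

section Hilbert

variable {H Z : Type*} [NormedAddCommGroup H] [InnerProductSpace ℝ H]
  [NormedAddCommGroup Z] [InnerProductSpace ℝ Z]

/-- A maximizing sequence of unit vectors has a subsequence with convergent images, and the
parallelogram law then makes that subsequence itself Cauchy, so no weak compactness is needed.
Injectivity makes the supremum positive. -/
theorem exists_maximizer [CompleteSpace H] {R : H →L[ℝ] Z} (hR : IsCompactOperator R)
    (hinj : ∀ u, R u = 0 → u = 0) {K : Submodule ℝ H} (hK : IsClosed (K : Set H)) (hne : K ≠ ⊥) :
    ∃ e ∈ K, ‖e‖ = 1 ∧ ∀ v ∈ K, ‖R v‖ ^ 2 ≤ ‖R e‖ ^ 2 * ‖v‖ ^ 2 := by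
  set S : Set ℝ := (fun u => ‖R u‖) '' {u | u ∈ K ∧ ‖u‖ = 1} with hS
  obtain ⟨v₀, hv₀, hv₀ne⟩ := Submodule.exists_mem_ne_zero_of_ne_bot hne
  have hunit : ∀ v ∈ K, v ≠ 0 → (‖v‖⁻¹ • v) ∈ {u | u ∈ K ∧ ‖u‖ = 1} := fun v hv hv0 =>
    ⟨K.smul_mem _ hv, by rw [norm_smul, norm_inv, norm_norm, inv_mul_cancel₀ (norm_ne_zero_iff.2 hv0)]⟩
  have hSne : S.Nonempty := ⟨_, mem_image_of_mem _ (hunit v₀ hv₀ hv₀ne)⟩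
  have hSb : BddAbove S := by
    refine ⟨‖R‖, ?_⟩
    rintro _ ⟨u, hu, rfl⟩
    simpa [hu.2] using R.le_opNorm u
  set M := sSup S with hM
  have hle : ∀ v ∈ K, ‖R v‖ ≤ M * ‖v‖ := by
    intro v hv
    rcases eq_or_ne v 0 with rfl | hv0
    · simp
    have h := le_csSup hSb (mem_image_of_mem (fun u => ‖R u‖) (hunit v hv hv0))
    simp only [map_smul, norm_smul, norm_inv, norm_norm] at h
    have hp : 0 < ‖v‖ := norm_pos_iff.2 hv0
    rwa [inv_mul_le_iff₀ hp, mul_comm] at h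
  have hMpos : 0 < M := by
    have h1 : 0 < ‖R v₀‖ := norm_pos_iff.2 fun h => hv₀ne (hinj _ h)
    have h2 := hle v₀ hv₀
    by_contra! h
    nlinarith [norm_nonneg v₀]
  obtain ⟨s, -, hs, hsS⟩ := exists_seq_tendsto_sSup hSne hSb
  choose u hu hus using hsS
  have hball : ∀ n, R (u n) ∈ closure (R '' Metric.closedBall 0 1) := fun n =>
    subset_closure (mem_image_of_mem _ (by simp [(hu n).2]))
  obtain ⟨z, -, φ, hφ, hz⟩ := (hR.isCompact_closure_image_closedBall 1).tendsto_subseq hball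
  have hlim : Filter.Tendsto (fun n => ‖R (u (φ n))‖) Filter.atTop (nhds M) := by
    have : (fun n => ‖R (u (φ n))‖) = s ∘ φ := funext fun n => hus (φ n)
    rw [this]
    exact hs.comp hφ.tendsto_atTop
  -- Apply ‖R w‖² ≤ M²‖w‖² to the sum w of two terms and expand both sides by the parallelogram law.
  -- The right-hand side tends to 4M² - 2M² - 2M² + 0 = 0.
  have hineq : ∀ n m, M ^ 2 * ‖u (φ n) - u (φ m)‖ ^ 2 ≤ 4 * M ^ 2 - 2 * ‖R (u (φ n))‖ ^ 2
      - 2 * ‖R (u (φ m))‖ ^ 2 + ‖R (u (φ n)) - R (u (φ m))‖ ^ 2 := by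
    intro n m
    have p1 := parallelogram_law_with_norm ℝ (u (φ n)) (u (φ m))
    have p2 := parallelogram_law_with_norm ℝ (R (u (φ n))) (R (u (φ m)))
    have h1 := hle _ (K.add_mem (hu (φ n)).1 (hu (φ m)).1)
    rw [map_add] at h1
    have h2 := pow_le_pow_left₀ (norm_nonneg _) h1 2
    rw [mul_pow] at h2
    rw [(hu (φ n)).2, (hu (φ m)).2] at p1
    have p3 : ‖u (φ n) + u (φ m)‖ ^ 2 = 4 - ‖u (φ n) - u (φ m)‖ ^ 2 := by nlinarith
    rw [p3] at h2
    nlinarith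
  have hcauchy : CauchySeq (u ∘ φ) := by
    rw [cauchySeq_iff_tendsto_dist_atTop_0]
    have t1 : Filter.Tendsto (fun p : ℕ × ℕ => ‖R (u (φ p.1))‖) Filter.atTop (nhds M) := by
      rw [← Filter.prod_atTop_atTop_eq]; exact hlim.comp Filter.tendsto_fst
    have t2 : Filter.Tendsto (fun p : ℕ × ℕ => ‖R (u (φ p.2))‖) Filter.atTop (nhds M) := by
      rw [← Filter.prod_atTop_atTop_eq]; exact hlim.comp Filter.tendsto_snd
    have t3 : Filter.Tendsto (fun p : ℕ × ℕ => ‖R (u (φ p.1)) - R (u (φ p.2))‖) Filter.atTop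
        (nhds 0) := by
      have := cauchySeq_iff_tendsto_dist_atTop_0.1 hz.cauchySeq
      simpa only [dist_eq_norm, Function.comp_apply] using this
    have t4 : Filter.Tendsto (fun p : ℕ × ℕ => Real.sqrt ((4 * M ^ 2 - 2 * ‖R (u (φ p.1))‖ ^ 2
        - 2 * ‖R (u (φ p.2))‖ ^ 2 + ‖R (u (φ p.1)) - R (u (φ p.2))‖ ^ 2) / M ^ 2)) Filter.atTop
        (nhds 0) := by
      have := (((((t1.pow 2).const_mul 2).const_sub (4 * M ^ 2)).sub ((t2.pow 2).const_mul 2)).add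
        (t3.pow 2)).div_const (M ^ 2) |>.sqrt
      convert this using 2
      rw [show 4 * M ^ 2 - 2 * M ^ 2 - 2 * M ^ 2 + 0 ^ 2 = 0 by ring]
      simp
    refine squeeze_zero (fun _ => dist_nonneg) (fun p => ?_) t4
    apply Real.le_sqrt_of_sq_le
    rw [le_div_iff₀ (by positivity), dist_eq_norm, mul_comm]
    exact hineq p.1 p.2
  obtain ⟨e, he⟩ := cauchySeq_tendsto_of_complete hcauchy
  have heK : e ∈ K := hK.mem_of_tendsto he (Filter.Eventually.of_forall fun n => (hu (φ n)).1)
  have he1 : ‖e‖ = 1 := by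
    refine tendsto_nhds_unique he.norm ?_
    simp only [Function.comp_apply, (hu _).2]
    exact tendsto_const_nhds
  have heM : ‖R e‖ = M :=
    tendsto_nhds_unique ((R.continuous.tendsto e).comp he).norm hlim
  refine ⟨e, heK, he1, fun v hv => ?_⟩
  rw [heM, ← mul_pow]
  exact pow_le_pow_left₀ (norm_nonneg _) (hle v hv) 2

/-- At a maximizer of `‖R v‖² / ‖v‖²` the first variation vanishes. -/
theorem inner_eq_of_maximizer {R : H →L[ℝ] Z} {K : Submodule ℝ H} {e : H} (he : e ∈ K)
    (he1 : ‖e‖ = 1) (hmax : ∀ v ∈ K, ‖R v‖ ^ 2 ≤ ‖R e‖ ^ 2 * ‖v‖ ^ 2) {v : H} (hv : v ∈ K) :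
    inner ℝ (R e) (R v) = ‖R e‖ ^ 2 * inner ℝ e v := by
  set m := ‖R e‖ ^ 2
  set β := m * inner ℝ e v - inner ℝ (R e) (R v) with hβ
  set q := m * ‖v‖ ^ 2 - ‖R v‖ ^ 2
  have hq : ∀ t : ℝ, 0 ≤ 2 * t * β + t ^ 2 * q := by
    intro t
    have h := hmax _ (K.add_mem he (K.smul_mem t hv))
    rw [map_add, map_smul, norm_add_sq_real, norm_add_sq_real, inner_smul_right, inner_smul_right,
      norm_smul, norm_smul, mul_pow, mul_pow, he1, Real.norm_eq_abs, sq_abs] at h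
    simp only [β, q]
    have : ‖R e‖ ^ 2 = m := rfl
    nlinarith
  have hβ0 : β = 0 := by
    by_contra hne
    have hq0 : 0 ≤ q := by
      have := hmax v hv
      simp only [q]
      linarith
    -- A step against the linear term makes the quadratic negative unless β = 0; q + 1 in the
    -- denominator allows q = 0.
    have h1 := hq (-β / (q + 1))
    have hpos : 0 < q + 1 := by linarith
    have e1 : 2 * (-β / (q + 1)) * β + (-β / (q + 1)) ^ 2 * q =
        -(β ^ 2 * (q + 2)) / (q + 1) ^ 2 := by
      field_simp
      ring
    rw [e1] at h1
    have : 0 < β ^ 2 * (q + 2) / (q + 1) ^ 2 := by positivity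
    rw [neg_div] at h1
    linarith
  linarith

/-- The result of successive maximization of `‖R v‖² / ‖v‖²` over orthogonal complements. -/
structure IsGreedy (R : H →L[ℝ] Z) (F : ℕ → Submodule ℝ H) (e : ℕ → H) : Prop where
  zero : F 0 = ⊥
  succ : ∀ n, F (n + 1) = F n ⊔ Submodule.span ℝ {e n}
  mem : ∀ n, (F n)ᗮ ≠ ⊥ → e n ∈ (F n)ᗮ
  norm_eq : ∀ n, (F n)ᗮ ≠ ⊥ → ‖e n‖ = 1
  max : ∀ n, (F n)ᗮ ≠ ⊥ → ∀ v ∈ (F n)ᗮ, ‖R v‖ ^ 2 ≤ ‖R (e n)‖ ^ 2 * ‖v‖ ^ 2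

/-- Once the orthogonal complement is trivial the pick is the junk value 0; this is why the fields
of `IsGreedy` are conditional. -/
theorem exists_isGreedy [CompleteSpace H] {R : H →L[ℝ] Z} (hR : IsCompactOperator R)
    (hinj : ∀ u, R u = 0 → u = 0) : ∃ F e, IsGreedy R F e := by
  have key : ∀ F : Submodule ℝ H, ∃ e, Fᗮ ≠ ⊥ → e ∈ Fᗮ ∧ ‖e‖ = 1 ∧
      ∀ v ∈ Fᗮ, ‖R v‖ ^ 2 ≤ ‖R e‖ ^ 2 * ‖v‖ ^ 2 := by
    intro F
    by_cases h : Fᗮ = ⊥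
    · exact ⟨0, fun h' => absurd h h'⟩
    · obtain ⟨e, h1, h2, h3⟩ := exists_maximizer hR hinj F.isClosed_orthogonal h
      exact ⟨e, fun _ => ⟨h1, h2, h3⟩⟩
  choose pick hpick using key
  let F : ℕ → Submodule ℝ H := fun n =>
    Nat.rec ⊥ (fun _ G => G ⊔ Submodule.span ℝ {pick G}) n
  exact ⟨F, fun n => pick (F n), rfl, fun _ => rfl, fun n h => (hpick _ h).1,
    fun n h => (hpick _ h).2.1, fun n h => (hpick _ h).2.2⟩

namespace IsGreedy

variable {R : H →L[ℝ] Z} {F : ℕ → Submodule ℝ H} {e : ℕ → H}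

theorem mono (h : IsGreedy R F e) : Monotone F :=
  monotone_nat_of_le_succ fun n => by rw [h.succ]; exact le_sup_left

theorem mem_F (h : IsGreedy R F e) {j n : ℕ} (hj : j < n) : e j ∈ F n := by
  refine h.mono (Nat.succ_le_of_lt hj) ?_
  rw [h.succ]
  exact Submodule.mem_sup_right (Submodule.mem_span_singleton_self _)

theorem mem_orthogonal_succ (h : IsGreedy R F e) {n : ℕ} {v : H} (hv : v ∈ (F n)ᗮ)
    (hev : inner ℝ (e n) v = 0) : v ∈ (F (n + 1))ᗮ := by
  rw [h.succ, ← Submodule.inf_orthogonal]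
  exact ⟨hv, Submodule.mem_orthogonal_singleton_iff_inner_right.2 hev⟩

theorem mem_orthogonal (h : IsGreedy R F e) {n : ℕ} {v : H}
    (hv : ∀ j < n, inner ℝ (e j) v = 0) : v ∈ (F n)ᗮ := by
  induction n with
  | zero => rw [h.zero, Submodule.bot_orthogonal_eq_top]; trivial
  | succ n ih => exact h.mem_orthogonal_succ (ih fun j hj => hv j (by omega)) (hv n (by omega))

theorem ne_bot_of_le (h : IsGreedy R F e) {j n : ℕ} (hjn : j ≤ n) (hn : (F n)ᗮ ≠ ⊥) :
    (F j)ᗮ ≠ ⊥ := fun h0 =>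
  hn (eq_bot_iff.2 ((Submodule.orthogonal_le (h.mono hjn)).trans h0.le))

theorem inner_eq_zero_of_lt (h : IsGreedy R F e) {j n : ℕ} (hjn : j < n) (hn : (F n)ᗮ ≠ ⊥) :
    inner ℝ (e j) (e n) = 0 := h.mem n hn _ (h.mem_F hjn)

theorem inner_map_eq (h : IsGreedy R F e) {n : ℕ} (hn : (F n)ᗮ ≠ ⊥) (v : H) :
    inner ℝ (R (e n)) (R v) = ‖R (e n)‖ ^ 2 * inner ℝ (e n) v := by
  have base : ∀ k, (F k)ᗮ ≠ ⊥ → ∀ v ∈ (F k)ᗮ,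
      inner ℝ (R (e k)) (R v) = ‖R (e k)‖ ^ 2 * inner ℝ (e k) v := fun k hk v hv =>
    inner_eq_of_maximizer (h.mem k hk) (h.norm_eq k hk) (h.max k hk) hv
  -- The first variation gives the identity only on (F n)ᗮ. Descending from k = n to k = 0 extends
  -- it: the component of `v` along `e k` contributes zero to both sides.
  have step : ∀ i k, k + i = n → ∀ v ∈ (F k)ᗮ,
      inner ℝ (R (e n)) (R v) = ‖R (e n)‖ ^ 2 * inner ℝ (e n) v := by
    intro i
    induction i with
    | zero => rintro k rfl v hv; exact base _ hn v hv
    | succ i ih =>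
      intro k hk v hv
      have hkn : k < n := by omega
      have hkb := h.ne_bot_of_le hkn.le hn
      set c := inner ℝ (e k) v
      have hw : v - c • e k ∈ (F (k + 1))ᗮ := by
        refine h.mem_orthogonal_succ (sub_mem hv (Submodule.smul_mem _ _ (h.mem k hkb))) ?_
        rw [inner_sub_right, inner_smul_right, real_inner_self_eq_norm_sq, h.norm_eq k hkb]
        simp [c]
      have h1 := ih (k + 1) (by omega) _ hw
      have h2 : inner ℝ (e n) (e k) = 0 := by
        rw [real_inner_comm]; exact h.inner_eq_zero_of_lt hkn hn
      have h3 : inner ℝ (R (e n)) (R (e k)) = 0 := by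
        rw [real_inner_comm, base k hkb _ (Submodule.orthogonal_le (h.mono hkn.le) (h.mem n hn)),
          h.inner_eq_zero_of_lt hkn hn, mul_zero]
      rw [map_sub, map_smul, inner_sub_right, inner_sub_right, inner_smul_right, inner_smul_right,
        h2, h3] at h1
      simpa using h1
  exact step n 0 (by omega) v (by rw [h.zero, Submodule.bot_orthogonal_eq_top]; trivial)

theorem antitone (h : IsGreedy R F e) {j n : ℕ} (hjn : j ≤ n) (hn : (F n)ᗮ ≠ ⊥) :
    ‖R (e n)‖ ^ 2 ≤ ‖R (e j)‖ ^ 2 := by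
  have := h.max j (h.ne_bot_of_le hjn hn) _ (Submodule.orthogonal_le (h.mono hjn) (h.mem n hn))
  rwa [h.norm_eq n hn, one_pow, mul_one] at this

theorem pos (h : IsGreedy R F e) (hinj : ∀ u, R u = 0 → u = 0) {n : ℕ} (hn : (F n)ᗮ ≠ ⊥) :
    0 < ‖R (e n)‖ ^ 2 := by
  have : R (e n) ≠ 0 := fun h0 => by
    have := h.norm_eq n hn
    rw [hinj _ h0, norm_zero] at this
    exact zero_ne_one this
  positivity

theorem finiteDimensional (h : IsGreedy R F e) (n : ℕ) : FiniteDimensional ℝ (F n) := by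
  induction n with
  | zero => rw [h.zero]; infer_instance
  | succ n ih => rw [h.succ]; infer_instance

theorem finrank_le (h : IsGreedy R F e) (n : ℕ) : Module.finrank ℝ (F n) ≤ n := by
  induction n with
  | zero => rw [h.zero]; simp
  | succ n ih =>
    have := h.finiteDimensional n
    rw [h.succ]
    refine (Submodule.finrank_add_le_finrank_add_finrank _ _).trans ?_
    have h1 : Module.finrank ℝ (Submodule.span ℝ {e n}) ≤ 1 :=
      (finrank_span_le_card {e n}).trans (by simp)
    omega

theorem eq_top (h : IsGreedy R F e) {n : ℕ} (hn : (F n)ᗮ = ⊥) : F n = ⊤ := by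
  have := h.finiteDimensional n
  exact Submodule.orthogonal_eq_bot_iff.1 hn

theorem orthonormal (h : IsGreedy R F e) {ι : Type*} {f : ι → ℕ} (hf : Function.Injective f)
    (hb : ∀ i, (F (f i))ᗮ ≠ ⊥) : Orthonormal ℝ fun i => e (f i) := by
  refine ⟨fun i => h.norm_eq _ (hb i), fun i j hij => ?_⟩
  rcases lt_or_gt_of_ne (hf.ne hij) with hlt | hlt
  · exact h.inner_eq_zero_of_lt hlt (hb j)
  · change inner ℝ (e (f i)) (e (f j)) = 0
    rw [real_inner_comm]
    exact h.inner_eq_zero_of_lt hlt (hb i)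

/-- The images of the `e n` are pairwise orthogonal. Were all their squared norms at least δ, their
squared mutual distances would be at least 2δ, contradicting compactness. -/
theorem exists_lt (h : IsGreedy R F e) (hR : IsCompactOperator R) (hb : ∀ n, (F n)ᗮ ≠ ⊥) {δ : ℝ}
    (hδ : 0 < δ) : ∃ n, ‖R (e n)‖ ^ 2 < δ := by
  by_contra! hc
  have hball : ∀ n, R (e n) ∈ closure (R '' Metric.closedBall 0 1) := fun n =>
    subset_closure (mem_image_of_mem _ (by simp [h.norm_eq n (hb n)]))
  obtain ⟨z, -, φ, hφ, hz⟩ := (hR.isCompact_closure_image_closedBall 1).tendsto_subseq hball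
  obtain ⟨n₀, hn₀⟩ := Metric.cauchySeq_iff'.1 hz.cauchySeq (Real.sqrt δ) (Real.sqrt_pos.2 hδ)
  have h1 := hn₀ (n₀ + 1) (by omega)
  rw [dist_eq_norm] at h1
  have h2 := pow_lt_pow_left₀ h1 (norm_nonneg _) two_ne_zero
  rw [Real.sq_sqrt hδ.le] at h2
  simp only [Function.comp_apply] at h2
  rw [norm_sub_sq_real, h.inner_map_eq (hb _), real_inner_comm,
    h.inner_eq_zero_of_lt (hφ (Nat.lt_succ_self n₀)) (hb _)] at h2
  linarith [hc (φ (n₀ + 1)), hc (φ n₀)]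

end IsGreedy

end Hilbert

/-! ### Eigensystems of `⟪A u, A v⟫ = lam ⟪B u, B v⟫` -/

section Eigensystem

variable {X Y Z : Type*} [AddCommGroup X] [Module ℝ X] [NormedAddCommGroup Y]
  [InnerProductSpace ℝ Y] [NormedAddCommGroup Z] [InnerProductSpace ℝ Z]

/-- The solutions `u ∈ W` of `⟪A u, A v⟫ = μ ⟪B u, B v⟫` for all `v ∈ W`. -/
def eigenspace (W : Submodule ℝ X) (A : X →ₗ[ℝ] Y) (B : X →ₗ[ℝ] Z) (μ : ℝ) : Submodule ℝ X where
  carrier := {u | u ∈ W ∧ ∀ v ∈ W, inner ℝ (A u) (A v) = μ * inner ℝ (B u) (B v)}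
  add_mem' := by
    rintro u w ⟨hu, hu'⟩ ⟨hw, hw'⟩
    refine ⟨add_mem hu hw, fun v hv => ?_⟩
    rw [map_add, map_add, inner_add_left, inner_add_left, hu' v hv, hw' v hv]
    ring
  zero_mem' := ⟨zero_mem _, fun v _ => by simp⟩
  smul_mem' := by
    rintro c u ⟨hu, hu'⟩
    refine ⟨W.smul_mem c hu, fun v hv => ?_⟩
    rw [map_smul, map_smul, real_inner_smul_left, real_inner_smul_left, hu' v hv]
    ring

/-- A complete sequence of eigenvectors, with the eigenvalues in nondecreasing order and the
variational characterization of the eigenvalues. -/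
structure IsEigensystem (W : Submodule ℝ X) (A : X →ₗ[ℝ] Y) (B : X →ₗ[ℝ] Z) {ι : Type}
    [LinearOrder ι] (lam : ι → ℝ) (e : ι → X) : Prop where
  mem : ∀ i, e i ∈ W
  mono : Monotone lam
  pos : ∀ i, 0 < lam i
  inner_eq : ∀ i, ∀ v ∈ W, inner ℝ (A (e i)) (A v) = lam i * inner ℝ (B (e i)) (B v)
  orthonormal : Orthonormal ℝ fun i => A (e i)
  le : ∀ i, ∀ u ∈ W, (∀ j < i, inner ℝ (B (e j)) (B u) = 0) → lam i * ‖B u‖ ^ 2 ≤ ‖A u‖ ^ 2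
  complete : ∀ μ, ∀ u ∈ eigenspace W A B μ, (∀ i, inner ℝ (A (e i)) (A u) = 0) → u = 0
  finite_fibre : ∀ μ, Finite {i // lam i = μ}

/-- The dimension count behind both eigenvalue comparisons: n linear conditions on n + 1
coefficients. -/
theorem exists_combination {n : ℕ} (E : Fin (n + 1) → X) (ℓ : Fin n → X →ₗ[ℝ] ℝ) :
    ∃ c : Fin (n + 1) → ℝ, c ≠ 0 ∧ ∀ s, ℓ s (∑ t, c t • E t) = 0 := by
  let Φ : (Fin (n + 1) → ℝ) →ₗ[ℝ] (Fin n → ℝ) :=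
    (LinearMap.pi ℓ) ∘ₗ (Fintype.linearCombination ℝ E)
  have h : LinearMap.ker Φ ≠ ⊥ := LinearMap.ker_ne_bot_of_finrank_lt (by simp)
  obtain ⟨c, hc, hc0⟩ := Submodule.exists_mem_ne_zero_of_ne_bot h
  refine ⟨c, hc0, fun s => ?_⟩
  have := congrFun (LinearMap.mem_ker.1 hc) s
  simpa [Φ, Fintype.linearCombination_apply] using this

namespace IsEigensystem

variable {W : Submodule ℝ X} {A : X →ₗ[ℝ] Y} {B : X →ₗ[ℝ] Z} {ι : Type} [LinearOrder ι]
  {lam : ι → ℝ} {e : ι → X}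

/-- Subtract from `u` its projection onto the listed eigenvectors for μ. The rest is orthogonal to
these by construction and to the others because their eigenvalues differ, so completeness makes it
zero. -/
theorem eigenspace_eq_span (h : IsEigensystem W A B lam e) (μ : ℝ) :
    eigenspace W A B μ = Submodule.span ℝ (range fun i : {i // lam i = μ} => e i) := by
  have hmem : ∀ i : {i // lam i = μ}, e i ∈ eigenspace W A B μ := fun i =>
    ⟨h.mem i, fun v hv => by rw [h.inner_eq i v hv, i.2]⟩
  apply le_antisymm
  · intro u hu
    have := h.finite_fibre μ
    have := Fintype.ofFinite {i // lam i = μ}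
    set p := ∑ i : {i // lam i = μ}, inner ℝ (A (e i)) (A u) • e i with hp
    have hpm : p ∈ Submodule.span ℝ (range fun i : {i // lam i = μ} => e i) :=
      Submodule.sum_mem _ fun i _ => Submodule.smul_mem _ _ (Submodule.subset_span ⟨i, rfl⟩)
    have hpe : p ∈ eigenspace W A B μ :=
      Submodule.sum_mem _ fun i _ => Submodule.smul_mem _ _ (hmem i)
    have hd := sub_mem hu hpe
    have h0 : u - p = 0 := by
      refine h.complete μ _ hd fun i => ?_
      by_cases hi : lam i = μ
      · have ho : Orthonormal ℝ fun i : {i // lam i = μ} => A (e i) :=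
          h.orthonormal.comp _ Subtype.val_injective
        have := ho.inner_right_fintype (fun i => inner ℝ (A (e i)) (A u)) ⟨i, hi⟩
        rw [map_sub, inner_sub_right, hp, map_sum]
        simp only [map_smul]
        rw [this, sub_self]
      · have h1 := h.inner_eq i _ hd.1
        have h2 := hd.2 _ (h.mem i)
        rw [real_inner_comm, h1, real_inner_comm] at h2
        have h3 : inner ℝ (B (u - p)) (B (e i)) = 0 := by
          have : (lam i - μ) * inner ℝ (B (u - p)) (B (e i)) = 0 := by linarith
          exact (mul_eq_zero.1 this).resolve_left (sub_ne_zero.2 hi)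
        rw [h1, real_inner_comm, h3, mul_zero]
    rw [sub_eq_zero.1 h0]
    exact hpm
  · rw [Submodule.span_le]
    rintro _ ⟨i, rfl⟩
    exact hmem i

theorem rank_eigenspace {X : Type} [AddCommGroup X] [Module ℝ X] {W : Submodule ℝ X}
    {A : X →ₗ[ℝ] Y} {B : X →ₗ[ℝ] Z} {e : ι → X} (h : IsEigensystem W A B lam e) (μ : ℝ) :
    Module.rank ℝ (eigenspace W A B μ) = Cardinal.mk {i // lam i = μ} := by
  have hl : LinearIndependent ℝ fun i : {i // lam i = μ} => e i :=
    LinearIndependent.of_comp A (h.orthonormal.comp _ Subtype.val_injective).linearIndependent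
  rw [h.eigenspace_eq_span, rank_span hl]
  exact Cardinal.mk_range_eq _ hl.injective

theorem norm_sq_combination (h : IsEigensystem W A B lam e) {n : ℕ} {f : Fin n → ι}
    (hf : Function.Injective f) (c : Fin n → ℝ) :
    ‖A (∑ t, c t • e (f t))‖ ^ 2 = ∑ t, c t ^ 2 := by
  have ho : Orthonormal ℝ fun t => A (e (f t)) := h.orthonormal.comp f hf
  rw [← real_inner_self_eq_norm_sq, map_sum]
  simp only [map_smul]
  rw [ho.inner_sum]
  simp [sq]

theorem combination_mem (h : IsEigensystem W A B lam e) {n : ℕ} (f : Fin n → ι) (c : Fin n → ℝ) :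
    ∑ t, c t • e (f t) ∈ W :=
  Submodule.sum_mem _ fun _ _ => Submodule.smul_mem _ _ (h.mem _)

/-- The eigenvectors are orthogonal for both forms, with ‖A u‖² = ∑ c² and ‖B u‖² = ∑ c²/λ, and
every λ that occurs is at most `lam i`. -/
theorem norm_sq_combination_le (h : IsEigensystem W A B lam e) {n : ℕ} {f : Fin n → ι}
    (hf : Function.Injective f) {i : ι} (hi : ∀ t, f t ≤ i) (c : Fin n → ℝ) :
    ‖A (∑ t, c t • e (f t))‖ ^ 2 ≤ lam i * ‖B (∑ t, c t • e (f t))‖ ^ 2 := by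
  set u := ∑ t, c t • e (f t) with hu
  have hAu : ∀ t, inner ℝ (A (e (f t))) (A u) = c t := by
    intro t
    have ho : Orthonormal ℝ fun t => A (e (f t)) := h.orthonormal.comp f hf
    have := ho.inner_right_fintype c t
    rw [hu, map_sum]
    simpa only [map_smul] using this
  have hB : ‖B u‖ ^ 2 = ∑ t, c t ^ 2 / lam (f t) := by
    rw [← real_inner_self_eq_norm_sq]
    have hBu : B u = ∑ t, c t • B (e (f t)) := by simp [hu]
    have hsum : inner ℝ (B u) (B u) = inner ℝ (∑ t, c t • B (e (f t))) (B u) :=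
      congrArg (fun y => inner ℝ y (B u)) hBu
    rw [hsum, sum_inner]
    refine Finset.sum_congr rfl fun t _ => ?_
    have h1 := h.inner_eq (f t) u (h.combination_mem f c)
    rw [hAu] at h1
    have h2 := (h.pos (f t)).ne'
    rw [real_inner_smul_left, eq_div_iff h2, sq]
    linear_combination (-c t) * h1
  rw [h.norm_sq_combination hf, hB, Finset.mul_sum]
  refine Finset.sum_le_sum fun t _ => ?_
  have h2 := h.pos (f t)
  rw [mul_div_assoc', le_div_iff₀ h2, mul_comm]
  exact mul_le_mul_of_nonneg_right (h.mono (hi t)) (sq_nonneg _)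

theorem norm_sq_combination_pos (h : IsEigensystem W A B lam e) {n : ℕ} {f : Fin n → ι}
    (hf : Function.Injective f) {c : Fin n → ℝ} (hc : c ≠ 0) :
    0 < ‖A (∑ t, c t • e (f t))‖ ^ 2 := by
  rw [h.norm_sq_combination hf]
  obtain ⟨t, ht⟩ := Function.ne_iff.1 hc
  exact Finset.sum_pos' (fun _ _ => sq_nonneg _) ⟨t, Finset.mem_univ _, sq_pos_of_ne_zero ht⟩

/-- Eigenvalues increase when the space gets smaller. -/
theorem le_of_le {n : ℕ} {V W : Submodule ℝ X} {P : ℕ → ℝ} {e : ℕ → X} {Q : Fin n → ℝ}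
    {f : Fin n → X} (hV : IsEigensystem V A B P e) (hW : IsEigensystem W A B Q f) (hWV : W ≤ V)
    (i : Fin n) : P i ≤ Q i := by
  let g : Fin (i + 1) → Fin n := fun t => ⟨t, by omega⟩
  have hg : Function.Injective g := fun s t hst => Fin.ext (by simpa [g] using hst)
  have hgi : ∀ t, g t ≤ i := fun t => Fin.le_def.2 (by simp only [g]; omega)
  -- A nonzero combination of the i + 1 lowest eigenvectors of the smaller space, b-orthogonal to
  -- the i lowest of the larger one: its Rayleigh quotient is at most `Q i` and at least `P i`.
  obtain ⟨c, hc, hcl⟩ := exists_combination (fun t => f (g t))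
    (fun s : Fin i => (innerₗ Z (B (e s))) ∘ₗ B)
  have hpos := hW.norm_sq_combination_pos hg hc
  have hle := hW.norm_sq_combination_le hg hgi c
  have hge := hV.le i _ (hWV (hW.combination_mem g c)) fun j hj => by
    exact hcl ⟨j, hj⟩
  have hB : 0 < ‖B (∑ t, c t • f (g t))‖ ^ 2 := by
    have := hW.pos i
    by_contra! h
    nlinarith
  exact le_of_mul_le_mul_right (hge.trans hle) hB

/-- A lower eigenvalue bound from a projection with an explicit error constant. -/
theorem div_le_of_projection {n : ℕ} {W : Submodule ℝ X} {A A' : X →ₗ[ℝ] Y} {P : ℕ → ℝ}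
    {e : ℕ → X} {Q : Fin n → ℝ} {f : Fin n → X} (hV : IsEigensystem ⊤ A B P e)
    (hW : IsEigensystem W A' B Q f) {pr : X →ₗ[ℝ] X} (hpr : ∀ u, pr u ∈ W) {C : ℝ}
    (hA : ∀ u, ‖A' u‖ ^ 2 ≤ ‖A u‖ ^ 2)
    (hsplit : ∀ u, ‖A' u‖ ^ 2 = ‖A' (pr u)‖ ^ 2 + ‖A' (u - pr u)‖ ^ 2)
    (herr : ∀ u, ‖B (u - pr u)‖ ≤ C * ‖A' (u - pr u)‖) (i : Fin n) :
    Q i / (1 + Q i * C ^ 2) ≤ P i := by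
  let g : Fin (i + 1) → ℕ := fun t => t
  have hg : Function.Injective g := Fin.val_injective
  have hgi : ∀ t, g t ≤ i := fun t => by simp only [g]; omega
  -- Here it is the projection of the combination that is made orthogonal to the i lowest discrete
  -- eigenvectors. That projection may vanish; only `u` has to be nonzero.
  obtain ⟨c, hc, hcl⟩ := exists_combination (fun t => e (g t))
    (fun s : Fin i => (innerₗ Z (B (f ⟨s, by omega⟩))) ∘ₗ B ∘ₗ pr)
  have hpos := hV.norm_sq_combination_pos hg hc
  have hle := hV.norm_sq_combination_le hg hgi c
  set u := ∑ t, c t • e (g t)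
  have hge := hW.le i _ (hpr u) fun j hj => by
    exact hcl ⟨j, hj⟩
  have hp := hV.pos i
  have hq := hW.pos i
  set p := P i
  set q := Q i
  have hB : 0 < ‖B u‖ ^ 2 := by
    by_contra! h
    nlinarith
  have hnorm : ‖B u‖ ≤ ‖B (pr u)‖ + ‖B (u - pr u)‖ := by
    calc ‖B u‖ = ‖B (pr u) + B (u - pr u)‖ := by rw [← map_add]; simp
      _ ≤ _ := norm_add_le _ _
  have hs := hsplit u
  have hAu := hA u
  have her := herr u
  set a := ‖B (pr u)‖
  set b := ‖A' (u - pr u)‖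
  have ha : 0 ≤ a := norm_nonneg _
  have h1 : ‖B u‖ ^ 2 ≤ (a + C * b) ^ 2 :=
    pow_le_pow_left₀ (norm_nonneg _) (hnorm.trans (by linarith)) 2
  -- Weighted Cauchy-Schwarz; the right side minus the left is exactly (qCa - b)².
  have h2 : q * (a + C * b) ^ 2 ≤ (1 + q * C ^ 2) * (q * a ^ 2 + b ^ 2) := by
    nlinarith [sq_nonneg (q * C * a - b)]
  have hK : 0 < 1 + q * C ^ 2 := by positivity
  have h3 : q * ‖B u‖ ^ 2 ≤ (1 + q * C ^ 2) * p * ‖B u‖ ^ 2 := by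
    calc q * ‖B u‖ ^ 2 ≤ q * (a + C * b) ^ 2 := mul_le_mul_of_nonneg_left h1 hq.le
      _ ≤ (1 + q * C ^ 2) * (q * a ^ 2 + b ^ 2) := h2
      _ ≤ (1 + q * C ^ 2) * (p * ‖B u‖ ^ 2) := by
        refine mul_le_mul_of_nonneg_left ?_ hK.le
        linarith
      _ = _ := by ring
  rw [div_le_iff₀ hK]
  have := le_of_mul_le_mul_right h3 hB
  linarith

end IsEigensystem

/-! ### Existence of eigensystems -/

variable {W : Submodule ℝ X} {A : X →ₗ[ℝ] Y} {B : X →ₗ[ℝ] Z} {T : Y →L[ℝ] Z}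

/-- The maximization runs on the image of W under A, where the problem reads ⟪y, z⟫ = λ⟪T y, T z⟫;
preimages under A give the eigenvectors. The map `f` selects an initial segment of the greedy
sequence: all of ℕ, or the indices below the dimension. -/
theorem isEigensystem_of_isGreedy (hT : ∀ u ∈ W, B u = T (A u))
    (hA : ∀ u ∈ W, A u = 0 → u = 0) (hB : ∀ u ∈ W, B u = 0 → u = 0)
    {F : ℕ → Submodule ℝ (W.map A)} {e : ℕ → W.map A}
    (h : IsGreedy (T ∘L (W.map A).subtypeL) F e) {ι : Type} [LinearOrder ι] {f : ι → ℕ}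
    (hf : StrictMono f) (hsurj : ∀ i, ∀ j < f i, ∃ i', f i' = j) (hb : ∀ i, (F (f i))ᗮ ≠ ⊥)
    (hcomplete : ∀ μ, ∀ u ∈ W, (∀ v ∈ W, inner ℝ (A u) (A v) = μ * inner ℝ (B u) (B v)) →
      (∀ i, inner ℝ (e (f i) : Y) (A u) = 0) → A u = 0)
    (hfin : ∀ μ, Finite {i // (‖T (e (f i))‖ ^ 2)⁻¹ = μ}) :
    ∃ (lam : ι → ℝ) (d : ι → X), IsEigensystem W A B lam d := by
  have hpre : ∀ y : W.map A, ∃ u ∈ W, A u = y := fun y => Submodule.mem_map.1 y.2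
  choose J hJW hJ using hpre
  have hinj : ∀ y : W.map A, (T ∘L (W.map A).subtypeL) y = 0 → y = 0 := by
    intro y hy
    have h1 : B (J y) = 0 := by rw [hT _ (hJW y), hJ]; exact hy
    have h2 := hB _ (hJW y) h1
    have h3 := hJ y
    rw [h2, map_zero] at h3
    exact Subtype.ext h3.symm
  have hpos : ∀ i, 0 < ‖T (e (f i))‖ ^ 2 := fun i => h.pos hinj (hb i)
  have heig : ∀ i, ∀ v ∈ W, inner ℝ (T (e (f i))) (B v) =
      ‖T (e (f i))‖ ^ 2 * inner ℝ (e (f i) : Y) (A v) := by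
    intro i v hv
    have := h.inner_map_eq (hb i) ⟨A v, Submodule.mem_map_of_mem hv⟩
    rw [hT v hv]
    exact this
  refine ⟨fun i => (‖T (e (f i))‖ ^ 2)⁻¹, fun i => J (e (f i)), ⟨fun i => hJW _, ?_,
    fun i => inv_pos.2 (hpos i), ?_, ?_, ?_, ?_, hfin⟩⟩
  · intro i j hij
    exact inv_anti₀ (hpos j) (h.antitone (hf.monotone hij) (hb j))
  · intro i v hv
    rw [hT _ (hJW _), hJ, heig i v hv, inv_mul_cancel_left₀ (hpos i).ne']
  · have := h.orthonormal hf.injective hb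
    have h2 := this.comp_linearIsometry (W.map A).subtypeₗᵢ
    simp only [hJ]
    exact h2
  · intro i u hu huj
    -- By the eigenvalue equation, b-orthogonality to an eigenvector is the same as energy
    -- orthogonality, so the maximality of `e (f i)` applies to A u.
    have hm : (⟨A u, Submodule.mem_map_of_mem hu⟩ : W.map A) ∈ (F (f i))ᗮ := by
      refine h.mem_orthogonal fun j hj => ?_
      obtain ⟨i', rfl⟩ := hsurj i j hj
      have h1 := huj i' (hf.lt_iff_lt.1 hj)
      rw [hT _ (hJW _), hJ, heig i' u hu] at h1
      exact (mul_eq_zero.1 h1).resolve_left (hpos i').ne'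
    have h2 := h.max _ (hb i) _ hm
    rw [inv_mul_le_iff₀ (hpos i), hT u hu]
    exact h2
  · intro μ u hu hui
    simp only [hJ] at hui
    exact hA u hu.1 (hcomplete μ u hu.1 hu.2 hui)

/-- In infinite dimension the process never stops, and compactness sends the eigenvalues to
infinity. Hence fibres are finite, and a solution for μ orthogonal to all eigenvectors would have
Rayleigh quotient above μ, so it is zero. -/
theorem exists_isEigensystem_nat (hT : ∀ u ∈ W, B u = T (A u)) (hTc : IsCompactOperator T)
    (hA : ∀ u ∈ W, A u = 0 → u = 0) (hB : ∀ u ∈ W, B u = 0 → u = 0)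
    (hW : IsComplete (W.map A : Set Y)) (hinf : ¬ FiniteDimensional ℝ (W.map A)) :
    ∃ (lam : ℕ → ℝ) (d : ℕ → X), IsEigensystem W A B lam d := by
  have : CompleteSpace (W.map A) := hW.completeSpace_coe
  have hpre : ∀ y : W.map A, ∃ u ∈ W, A u = y := fun y => Submodule.mem_map.1 y.2
  have hinj : ∀ y : W.map A, (T ∘L (W.map A).subtypeL) y = 0 → y = 0 := by
    intro y hy
    obtain ⟨u, hu, huy⟩ := hpre y
    have h1 : B u = 0 := by rw [hT _ hu, huy]; exact hy
    rw [hB _ hu h1, map_zero] at huy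
    exact Subtype.ext huy.symm
  have hRc : IsCompactOperator (T ∘L (W.map A).subtypeL) := hTc.comp_clm _
  obtain ⟨F, e, h⟩ := exists_isGreedy hRc hinj
  have hb : ∀ n, (F n)ᗮ ≠ ⊥ := by
    intro n hn
    have h1 := h.eq_top hn
    have h2 := h.finiteDimensional n
    rw [h1] at h2
    exact hinf (Module.Finite.equiv (Submodule.topEquiv (R := ℝ) (M := W.map A)))
  have hpos : ∀ n, 0 < ‖T (e n)‖ ^ 2 := fun n => h.pos hinj (hb n)
  have hlarge : ∀ c : ℝ, ∃ n, ∀ k, n ≤ k → c < (‖T (e k)‖ ^ 2)⁻¹ := by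
    intro c
    obtain ⟨n, hn⟩ := h.exists_lt hRc hb (δ := (max c 1)⁻¹) (by positivity)
    refine ⟨n, fun k hk => ?_⟩
    have h1 : ‖T (e k)‖ ^ 2 < (max c 1)⁻¹ := (h.antitone hk (hb k)).trans_lt hn
    exact (le_max_left c 1).trans_lt ((lt_inv_comm₀ (hpos k) (by positivity)).1 h1)
  refine isEigensystem_of_isGreedy hT hA hB h (f := id) strictMono_id (fun i j _ => ⟨j, rfl⟩) hb
    ?_ ?_
  · intro μ u hu hmu hui
    have hBu : ∀ n, ‖B u‖ ^ 2 ≤ ‖T (e n)‖ ^ 2 * ‖A u‖ ^ 2 := by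
      intro n
      have := h.max n (hb n) ⟨A u, Submodule.mem_map_of_mem hu⟩
        (h.mem_orthogonal fun j _ => hui j)
      rw [hT u hu]
      exact this
    obtain ⟨n, hn⟩ := hlarge μ
    have h1 := hn n le_rfl
    have h2 := hmu u hu
    rw [real_inner_self_eq_norm_sq, real_inner_self_eq_norm_sq] at h2
    by_contra hne
    have h3 : 0 < ‖A u‖ ^ 2 := by
      have := norm_pos_iff.2 hne
      positivity
    have h4 := hBu n
    have h5 : (‖T (e n)‖ ^ 2)⁻¹ * ‖B u‖ ^ 2 ≤ ‖A u‖ ^ 2 := by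
      rwa [inv_mul_le_iff₀ (hpos n)]
    have h6 : 0 < ‖B u‖ ^ 2 := by
      rcases (sq_nonneg ‖B u‖).lt_or_eq with h6 | h6
      · exact h6
      · rw [← h6, mul_zero] at h2
        exact absurd h2 h3.ne'
    nlinarith
  · intro μ
    obtain ⟨n, hn⟩ := hlarge μ
    refine Set.Finite.to_subtype (s := {i | (‖T (e (id i))‖ ^ 2)⁻¹ = μ})
      ((Set.finite_lt_nat n).subset fun i hi => ?_)
    by_contra hc
    exact (hn i (not_lt.1 hc)).ne' hi

/-- A is injective on W, so its image has the same dimension. The process cannot stop before that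
many steps, and the vectors then found form an orthonormal basis, which is completeness. -/
theorem exists_isEigensystem_fin (hT : ∀ u ∈ W, B u = T (A u))
    (hA : ∀ u ∈ W, A u = 0 → u = 0) (hB : ∀ u ∈ W, B u = 0 → u = 0)
    [FiniteDimensional ℝ W] :
    ∃ (lam : Fin (Module.finrank ℝ W) → ℝ) (d : Fin (Module.finrank ℝ W) → X),
      IsEigensystem W A B lam d := by
  have hpre : ∀ y : W.map A, ∃ u ∈ W, A u = y := fun y => Submodule.mem_map.1 y.2
  have hinj : ∀ y : W.map A, (T ∘L (W.map A).subtypeL) y = 0 → y = 0 := by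
    intro y hy
    obtain ⟨u, hu, huy⟩ := hpre y
    have h1 : B u = 0 := by rw [hT _ hu, huy]; exact hy
    rw [hB _ hu h1, map_zero] at huy
    exact Subtype.ext huy.symm
  have hdim : Module.finrank ℝ (W.map A) = Module.finrank ℝ W := by
    have hi : Function.Injective (A.domRestrict W) := by
      rw [← LinearMap.ker_eq_bot, LinearMap.ker_eq_bot']
      exact fun u hu => Subtype.ext (hA u u.2 hu)
    have := LinearMap.finrank_range_of_inj hi
    rwa [LinearMap.range_domRestrict] at this
  have : CompleteSpace (W.map A) := FiniteDimensional.complete ℝ _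
  have hRc : IsCompactOperator (T ∘L (W.map A).subtypeL) := by
    have : ProperSpace (W.map A) := FiniteDimensional.proper ℝ _
    exact isCompactOperator_of_locallyCompactSpace_rng _
  obtain ⟨F, e, h⟩ := exists_isGreedy hRc hinj
  have hb : ∀ i : Fin (Module.finrank ℝ W), (F i)ᗮ ≠ ⊥ := by
    intro i hi
    have h1 := h.finrank_le i
    rw [h.eq_top hi, finrank_top, hdim] at h1
    omega
  refine isEigensystem_of_isGreedy hT hA hB h (f := fun i : Fin (Module.finrank ℝ W) => (i : ℕ))
    (fun _ _ hij => hij) (fun i j hj => ⟨⟨j, hj.trans i.2⟩, rfl⟩) hb ?_ fun _ => inferInstance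
  intro _ u hu _ hui
  have ho := h.orthonormal (f := fun i : Fin (Module.finrank ℝ W) => (i : ℕ)) Fin.val_injective hb
  have hspan := ho.linearIndependent.span_eq_top_of_card_eq_finrank' (by rw [Fintype.card_fin, hdim])
  have hmem : (⟨A u, Submodule.mem_map_of_mem hu⟩ : W.map A) ∈
      (Submodule.span ℝ (range fun i : Fin (Module.finrank ℝ W) => e i))ᗮ := by
    rw [Submodule.mem_orthogonal]
    intro y hy
    induction hy using Submodule.span_induction with
    | mem y hy => obtain ⟨i, rfl⟩ := hy; exact hui i
    | zero => simp
    | add y z _ _ hy hz => rw [inner_add_left, hy, hz, add_zero]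
    | smul c y _ hy => rw [real_inner_smul_left, hy, mul_zero]
  rw [hspan, Submodule.top_orthogonal_eq_bot, Submodule.mem_bot] at hmem
  exact congrArg Subtype.val hmem

end Eigensystem

/-! ### The operators of the buckling problem -/

section Operators

variable {L : ℝ}

theorem weakDeriv_spec {u : L2 L} (hu : u ∈ H20 L) :
    IsWeakDeriv L u (weakDeriv L u) ∧
      IsWeakDeriv L (weakDeriv L u) (weakDeriv L (weakDeriv L u)) := by
  obtain ⟨v₁, v₂, h1, h2, -, -⟩ := hu
  rw [h1.weakDeriv_eq, h2.weakDeriv_eq]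
  exact ⟨h1, h2⟩

/-- `u ↦ u'` on `H²₀(0, L)`. -/
def derivH20 (L : ℝ) : H20 L →ₗ[ℝ] L2 L where
  toFun u := weakDeriv L u
  map_add' u v := ((weakDeriv_spec u.2).1.add (weakDeriv_spec v.2).1).weakDeriv_eq
  map_smul' c u := ((weakDeriv_spec u.2).1.smul c).weakDeriv_eq

theorem derivH20_apply (u : H20 L) : derivH20 L u = weakDeriv L u := rfl

/-- `u ↦ u''` on `H²₀(0, L)`. -/
def derivTwoH20 (L : ℝ) : H20 L →ₗ[ℝ] L2 L where
  toFun u := weakDeriv L (weakDeriv L u)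
  map_add' u v := by
    have h := (derivH20 L).map_add u v
    simp only [derivH20_apply] at h
    rw [h]
    exact ((weakDeriv_spec u.2).2.add (weakDeriv_spec v.2).2).weakDeriv_eq
  map_smul' c u := by
    have h := (derivH20 L).map_smul c u
    simp only [derivH20_apply] at h
    rw [h]
    exact ((weakDeriv_spec u.2).2.smul c).weakDeriv_eq

theorem derivTwoH20_apply (u : H20 L) : derivTwoH20 L u = weakDeriv L (weakDeriv L u) := rfl

/-- The value at `L` of the primitive. -/
def primEnd (hL : 0 ≤ L) : L2 L →L[ℝ] ℝ :=
  LinearMap.mkContinuous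
    { toFun := fun g => prim g L
      map_add' := fun f g => prim_add f g (right_mem_Icc.2 hL)
      map_smul' := fun c f => prim_smul c f (right_mem_Icc.2 hL) }
    (Real.sqrt L) fun g => abs_prim_le g (right_mem_Icc.2 hL)

theorem primEnd_apply (hL : 0 ≤ L) (g : L2 L) : primEnd hL g = prim g L := rfl

theorem derivTwoH20_spec (hL : 0 < L) (u : H20 L) :
    derivH20 L u = primL L (derivTwoH20 L u) ∧ (u : L2 L) = primL L (primL L (derivTwoH20 L u)) ∧
      prim (derivTwoH20 L u) L = 0 ∧ prim (primL L (derivTwoH20 L u)) L = 0 := by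
  obtain ⟨g, h1, h2, h3⟩ := (mem_H20_iff hL).1 u.2
  have e : derivH20 L u = primL L g := by rw [derivH20_apply, h3, weakDeriv_primL hL]
  have e2 : derivTwoH20 L u = g := by
    rw [derivTwoH20_apply, ← derivH20_apply, e, weakDeriv_primL hL]
  rw [e2]
  exact ⟨e, h3, h1, h2⟩

theorem mem_range_derivTwoH20 (hL : 0 < L) {g : L2 L} :
    g ∈ LinearMap.range (derivTwoH20 L) ↔ prim g L = 0 ∧ prim (primL L g) L = 0 := by
  constructor
  · rintro ⟨u, rfl⟩
    exact (derivTwoH20_spec hL u).2.2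
  · rintro ⟨h1, h2⟩
    refine ⟨⟨primL L (primL L g), (mem_H20_iff hL).2 ⟨g, h1, h2, rfl⟩⟩, ?_⟩
    rw [derivTwoH20_apply, weakDeriv_primL hL, weakDeriv_primL hL]

theorem polyOn_injective (hL : 0 < L) : Function.Injective (polyOn L 0 L) := by
  rw [← LinearMap.ker_eq_bot, LinearMap.ker_eq_bot']
  intro p hp
  have hEq : EqOn (fun t => p.eval t) (fun _ => 0) (Icc 0 L) := by
    refine Measure.eqOn_Icc_of_ae_eq volume hL.ne ?_ p.continuous.continuousOn continuousOn_const
    rw [← Measure.restrict_congr_set (Ioo_ae_eq_Icc (μ := volume))]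
    have h := coeFn_polyOn L 0 L p
    rw [hp] at h
    filter_upwards [h, Lp.coeFn_zero ℝ 2 (volume.restrict (Ioo 0 L)),
      ae_restrict_mem measurableSet_Ioo] with t h1 h2 h3
    rw [h2, indicator_of_mem (Ioo_subset_Ico_self h3)] at h1
    exact h1.symm
  exact Polynomial.eq_zero_of_infinite_isRoot p ((Icc_infinite hL).mono fun t ht => hEq ht)

/-- The range is the kernel of two functionals, hence of finite codimension in L², and L² contains
all polynomials. -/
theorem not_finiteDimensional_range_derivTwoH20 (hL : 0 < L) :
    ¬ FiniteDimensional ℝ (LinearMap.range (derivTwoH20 L)) := by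
  intro hf
  let φ : L2 L →ₗ[ℝ] ℝ × ℝ :=
    (primEnd hL.le : L2 L →ₗ[ℝ] ℝ).prod ((primEnd hL.le ∘L primL L : L2 L →L[ℝ] ℝ) : L2 L →ₗ[ℝ] ℝ)
  have hker : LinearMap.ker φ = LinearMap.range (derivTwoH20 L) := by
    ext g
    rw [mem_range_derivTwoH20 hL, LinearMap.mem_ker, Prod.ext_iff]
    rfl
  rw [← hker] at hf
  have : FiniteDimensional ℝ (L2 L ⧸ LinearMap.ker φ) :=
    Module.Finite.equiv φ.quotKerEquivRange.symm
  have : FiniteDimensional ℝ (L2 L) := Module.Finite.of_submodule_quotient (LinearMap.ker φ)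
  exact Polynomial.not_finite (R := ℝ) (Module.Finite.of_injective _ (polyOn_injective hL))

theorem exists_mulOperator {m : ℝ → ℝ} (hm : AEMeasurable m (volume.restrict (Ioo 0 L))) {C : ℝ}
    (hC : ∀ t ∈ Ioo 0 L, |m t| ≤ C) :
    ∃ M : L2 L →L[ℝ] L2 L, ∀ g, M g =ᵐ[volume.restrict (Ioo 0 L)] fun t => m t * g t := by
  have hC' : ∀ᵐ t ∂(volume.restrict (Ioo 0 L)), |m t| ≤ C :=
    (ae_restrict_iff' measurableSet_Ioo).2 (Filter.Eventually.of_forall hC)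
  have hb : ∀ g : L2 L, ∀ᵐ t ∂(volume.restrict (Ioo 0 L)), ‖m t * g t‖ ≤ C * ‖g t‖ := fun g => by
    filter_upwards [hC'] with t ht
    rw [norm_mul]
    exact mul_le_mul_of_nonneg_right ht (norm_nonneg _)
  have hmem : ∀ g : L2 L, MemLp (fun t => m t * g t) 2 (volume.restrict (Ioo 0 L)) := fun g =>
    (Lp.memLp g).of_le_mul (hm.aestronglyMeasurable.mul (Lp.aestronglyMeasurable g)) (hb g)
  refine ⟨LinearMap.mkContinuous
    { toFun := fun g => (hmem g).toLp
      map_add' := fun f g => by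
        apply Lp.ext
        filter_upwards [(hmem (f + g)).coeFn_toLp, (hmem f).coeFn_toLp, (hmem g).coeFn_toLp,
          Lp.coeFn_add (hmem f).toLp (hmem g).toLp, Lp.coeFn_add f g] with x h1 h2 h3 h4 h5
        rw [h1, h4, Pi.add_apply, h2, h3, h5, Pi.add_apply, mul_add]
      map_smul' := fun c f => by
        apply Lp.ext
        filter_upwards [(hmem (c • f)).coeFn_toLp, (hmem f).coeFn_toLp,
          Lp.coeFn_smul c (hmem f).toLp, Lp.coeFn_smul c f] with x h1 h2 h4 h5
        rw [h1, RingHom.id_apply, h4, Pi.smul_apply, h2, h5, Pi.smul_apply, smul_eq_mul,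
          smul_eq_mul]
        ring } C (fun g => ?_), fun g => (hmem g).coeFn_toLp⟩
  refine Lp.norm_le_mul_norm_of_ae_le_mul ?_
  filter_upwards [(hmem g).coeFn_toLp, hb g] with t h1 h2
  simp only [LinearMap.coe_mk, AddHom.coe_mk]
  rw [h1]
  exact h2

/-- A stiffness bounded between two positive constants. -/
structure IsStiffness (L : ℝ) (ρ : ℝ → ℝ) (c C : ℝ) : Prop where
  aemeasurable : AEMeasurable ρ (volume.restrict (Ioo 0 L))
  pos : 0 < c
  le : ∀ t ∈ Ioo 0 L, c ≤ ρ t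
  ge : ∀ t ∈ Ioo 0 L, ρ t ≤ C

namespace IsStiffness

variable {ρ : ℝ → ℝ} {c C : ℝ}

theorem exists_sqrt (h : IsStiffness L ρ c C) : ∃ M : L2 L →L[ℝ] L2 L,
    ∀ g, M g =ᵐ[volume.restrict (Ioo 0 L)] fun t => Real.sqrt (ρ t) * g t :=
  exists_mulOperator (C := Real.sqrt C) h.aemeasurable.sqrt fun t ht => by
    rw [abs_of_nonneg (Real.sqrt_nonneg _)]
    exact Real.sqrt_le_sqrt (h.ge t ht)

theorem exists_sqrt_inv (h : IsStiffness L ρ c C) : ∃ M : L2 L →L[ℝ] L2 L,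
    ∀ g, M g =ᵐ[volume.restrict (Ioo 0 L)] fun t => (Real.sqrt (ρ t))⁻¹ * g t :=
  exists_mulOperator (C := (Real.sqrt c)⁻¹) h.aemeasurable.sqrt.inv fun t ht => by
    rw [abs_of_nonneg (inv_nonneg.2 (Real.sqrt_nonneg _))]
    exact inv_anti₀ (Real.sqrt_pos.2 h.pos) (Real.sqrt_le_sqrt (h.le t ht))

/-- Multiplication by the square root of the stiffness. -/
def sqrtMul (h : IsStiffness L ρ c C) : L2 L →L[ℝ] L2 L := h.exists_sqrt.choose

/-- Division by the square root of the stiffness. -/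
def sqrtDiv (h : IsStiffness L ρ c C) : L2 L →L[ℝ] L2 L := h.exists_sqrt_inv.choose

theorem coeFn_sqrtMul (h : IsStiffness L ρ c C) (g : L2 L) :
    h.sqrtMul g =ᵐ[volume.restrict (Ioo 0 L)] fun t => Real.sqrt (ρ t) * g t :=
  h.exists_sqrt.choose_spec g

theorem coeFn_sqrtDiv (h : IsStiffness L ρ c C) (g : L2 L) :
    h.sqrtDiv g =ᵐ[volume.restrict (Ioo 0 L)] fun t => (Real.sqrt (ρ t))⁻¹ * g t :=
  h.exists_sqrt_inv.choose_spec g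

theorem sqrt_ne_zero (h : IsStiffness L ρ c C) :
    ∀ᵐ t ∂(volume.restrict (Ioo 0 L)), Real.sqrt (ρ t) ≠ 0 := by
  filter_upwards [ae_restrict_mem measurableSet_Ioo] with t ht
  exact (Real.sqrt_pos.2 (h.pos.trans_le (h.le t ht))).ne'

theorem sqrtDiv_sqrtMul (h : IsStiffness L ρ c C) (g : L2 L) : h.sqrtDiv (h.sqrtMul g) = g := by
  apply Lp.ext
  filter_upwards [h.coeFn_sqrtDiv (h.sqrtMul g), h.coeFn_sqrtMul g, h.sqrt_ne_zero] with t h1 h2 h3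
  rw [h1, h2, inv_mul_cancel_left₀ h3]

theorem sqrtMul_sqrtDiv (h : IsStiffness L ρ c C) (g : L2 L) : h.sqrtMul (h.sqrtDiv g) = g := by
  apply Lp.ext
  filter_upwards [h.coeFn_sqrtMul (h.sqrtDiv g), h.coeFn_sqrtDiv g, h.sqrt_ne_zero] with t h1 h2 h3
  rw [h1, h2, mul_inv_cancel_left₀ h3]

theorem integrand_eq (h : IsStiffness L ρ c C) (f g : L2 L) :
    (fun t => h.sqrtMul f t * h.sqrtMul g t) =ᵐ[volume.restrict (Ioo 0 L)]
      fun t => ρ t * f t * g t := by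
  filter_upwards [h.coeFn_sqrtMul f, h.coeFn_sqrtMul g, ae_restrict_mem measurableSet_Ioo]
    with t h1 h2 h3
  have h4 : Real.sqrt (ρ t) * Real.sqrt (ρ t) = ρ t :=
    Real.mul_self_sqrt (h.pos.le.trans (h.le t h3))
  rw [h1, h2]
  linear_combination (f t * g t) * h4

theorem integrable (h : IsStiffness L ρ c C) (f g : L2 L) :
    Integrable (fun t => ρ t * f t * g t) (volume.restrict (Ioo 0 L)) :=
  (MemLp.integrable_mul (Lp.memLp (h.sqrtMul f)) (Lp.memLp (h.sqrtMul g))).congr (h.integrand_eq f g)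

theorem inner_sqrtMul (h : IsStiffness L ρ c C) (f g : L2 L) :
    inner ℝ (h.sqrtMul f) (h.sqrtMul g) = ∫ t in Ioo 0 L, ρ t * f t * g t := by
  rw [← integral_congr_ae (h.integrand_eq f g), L2.inner_def]
  simp [mul_comm]

/-- `u ↦ √ρ u''` on `H²₀(0, L)`. -/
def energyMap (h : IsStiffness L ρ c C) : H20 L →ₗ[ℝ] L2 L :=
  (h.sqrtMul : L2 L →ₗ[ℝ] L2 L) ∘ₗ derivTwoH20 L

theorem energyMap_apply (h : IsStiffness L ρ c C) (u : H20 L) :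
    h.energyMap u = h.sqrtMul (derivTwoH20 L u) := rfl

theorem formA_eq (h : IsStiffness L ρ c C) (u v : H20 L) :
    formA L ρ u v = inner ℝ (h.energyMap u) (h.energyMap v) :=
  (h.inner_sqrtMul _ _).symm

theorem eq_zero_of_energyMap (hL : 0 < L) (h : IsStiffness L ρ c C) {u : H20 L}
    (hu : h.energyMap u = 0) : u = 0 := by
  have h1 : derivTwoH20 L u = 0 := by
    rw [← h.sqrtDiv_sqrtMul (derivTwoH20 L u), ← h.energyMap_apply, hu, map_zero]
  apply Subtype.ext
  rw [(derivTwoH20_spec hL u).2.1, h1, map_zero, map_zero]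
  rfl

/-- The factorization B = T ∘ A on which the abstract theory rests. -/
theorem derivH20_eq (hL : 0 < L) (h : IsStiffness L ρ c C) (u : H20 L) :
    derivH20 L u = (primL L ∘L h.sqrtDiv) (h.energyMap u) := by
  rw [(derivTwoH20_spec hL u).1, ContinuousLinearMap.comp_apply, h.energyMap_apply,
    h.sqrtDiv_sqrtMul]

theorem isCompactOperator (hL : 0 < L) (h : IsStiffness L ρ c C) :
    IsCompactOperator (primL L ∘L h.sqrtDiv) :=
  (isCompactOperator_primL hL).comp_clm h.sqrtDiv

theorem mem_range_energyMap (h : IsStiffness L ρ c C) {y : L2 L} :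
    y ∈ LinearMap.range h.energyMap ↔ h.sqrtDiv y ∈ LinearMap.range (derivTwoH20 L) := by
  constructor
  · rintro ⟨u, rfl⟩
    exact ⟨u, by rw [h.energyMap_apply, h.sqrtDiv_sqrtMul]⟩
  · rintro ⟨u, hu⟩
    exact ⟨u, by rw [h.energyMap_apply, hu, h.sqrtMul_sqrtDiv]⟩

theorem isClosed_range (hL : 0 < L) (h : IsStiffness L ρ c C) :
    IsClosed (LinearMap.range h.energyMap : Set (L2 L)) := by
  have e : (LinearMap.range h.energyMap : Set (L2 L)) =
      {y | primEnd hL.le (h.sqrtDiv y) = 0} ∩ {y | primEnd hL.le (primL L (h.sqrtDiv y)) = 0} := by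
    ext y
    rw [SetLike.mem_coe, h.mem_range_energyMap, mem_range_derivTwoH20 hL]
    rfl
  rw [e]
  exact (isClosed_eq (by fun_prop) continuous_const).inter
    (isClosed_eq (by fun_prop) continuous_const)

theorem not_finiteDimensional_range (hL : 0 < L) (h : IsStiffness L ρ c C) :
    ¬ FiniteDimensional ℝ (LinearMap.range h.energyMap) := by
  intro hf
  apply not_finiteDimensional_range_derivTwoH20 hL
  have e : LinearMap.range (derivTwoH20 L) =
      (LinearMap.range h.energyMap).map (h.sqrtDiv : L2 L →ₗ[ℝ] L2 L) := by
    ext g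
    rw [Submodule.mem_map]
    constructor
    · rintro ⟨u, rfl⟩
      exact ⟨h.energyMap u, ⟨u, rfl⟩, h.sqrtDiv_sqrtMul _⟩
    · rintro ⟨_, ⟨u, rfl⟩, rfl⟩
      exact ⟨u, (h.sqrtDiv_sqrtMul _).symm⟩
  rw [e]
  infer_instance

end IsStiffness

theorem eq_zero_of_derivH20 (hL : 0 < L) {u : H20 L} (hu : derivH20 L u = 0) : u = 0 := by
  have h1 := (weakDeriv_spec u.2).1.eq_primL hL
  obtain ⟨v₁, v₂, h2, -, h3, -⟩ := u.2
  have h4 := (h1 h3).1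
  rw [← derivH20_apply, hu, map_zero] at h4
  exact Subtype.ext h4

theorem formB_eq (u v : H20 L) : formB L u v = inner ℝ (derivH20 L u) (derivH20 L v) := by
  rw [L2.inner_def]
  simp [formB, derivH20_apply, mul_comm]

/-- An eigensystem gives an enumeration of the eigenvalues. -/
theorem IsEigensystem.isEigenvalueEnumeration {ρ : ℝ → ℝ} {c C : ℝ} (h : IsStiffness L ρ c C)
    {W : Submodule ℝ (L2 L)} (hW : W ≤ H20 L) {ι : Type} [LinearOrder ι] {lam : ι → ℝ}
    {e : ι → H20 L}
    (hs : IsEigensystem (W.comap (H20 L).subtype) h.energyMap (derivH20 L) lam e) :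
    IsEigenvalueEnumeration L ρ W lam := by
  refine ⟨hs.mono, fun μ => ?_⟩
  rw [← hs.rank_eigenspace μ, multiplicity]
  -- The solution set is already a subspace, so the span in `multiplicity` adds nothing.
  have e1 : weakSolutions L ρ W μ = ((eigenspace (W.comap (H20 L).subtype) h.energyMap
      (derivH20 L) μ).map (H20 L).subtype : Set (L2 L)) := by
    ext u
    constructor
    · rintro ⟨hu, huv⟩
      refine ⟨⟨u, hW hu⟩, ⟨hu, fun v hv => ?_⟩, rfl⟩
      rw [← h.formA_eq, ← formB_eq]
      exact huv v hv
    · rintro ⟨u, ⟨hu, huv⟩, rfl⟩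
      refine ⟨hu, fun v hv => ?_⟩
      have := huv ⟨v, hW hv⟩ hv
      rw [← h.formA_eq, ← formB_eq] at this
      exact this
  rw [e1, Submodule.span_eq]
  exact (Submodule.equivMapOfInjective _ (H20 L).injective_subtype _).rank_eq

theorem IsStiffness.exists_isEigensystem_H20 (hL : 0 < L) {ρ : ℝ → ℝ} {c C : ℝ}
    (h : IsStiffness L ρ c C) :
    ∃ (lam : ℕ → ℝ) (e : ℕ → H20 L), IsEigensystem ⊤ h.energyMap (derivH20 L) lam e := by
  refine exists_isEigensystem_nat (fun u _ => h.derivH20_eq hL u) (h.isCompactOperator hL)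
    (fun u _ => h.eq_zero_of_energyMap hL) (fun u _ => eq_zero_of_derivH20 hL) ?_ ?_
  · rw [Submodule.map_top]
    exact (h.isClosed_range hL).isComplete
  · rw [Submodule.map_top]
    exact h.not_finiteDimensional_range hL

theorem IsStiffness.exists_isEigensystem_fin (hL : 0 < L) {ρ : ℝ → ℝ} {c C : ℝ}
    (h : IsStiffness L ρ c C) {W : Submodule ℝ (L2 L)} (hW : W ≤ H20 L) [FiniteDimensional ℝ W] :
    ∃ (lam : Fin (Module.finrank ℝ W) → ℝ) (e : Fin (Module.finrank ℝ W) → H20 L),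
      IsEigensystem (W.comap (H20 L).subtype) h.energyMap (derivH20 L) lam e := by
  have E := Submodule.comapSubtypeEquivOfLe hW
  have : FiniteDimensional ℝ (W.comap (H20 L).subtype) := Module.Finite.equiv E.symm
  rw [← E.finrank_eq]
  exact BeamBuckling.exists_isEigensystem_fin (fun u _ => h.derivH20_eq hL u)
    (fun u _ => h.eq_zero_of_energyMap hL) (fun u _ => eq_zero_of_derivH20 hL)

end Operators

/-! ### The piecewise constant stiffness -/

section Mesh

variable {L : ℝ} {N : ℕ} {x : Fin (N + 1) → ℝ} {EI : ℝ → ℝ} {C₁ C₂ : ℝ}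

theorem elementMin_bounds (hx : IsPartition L x) (hEI : ∀ t ∈ Ioo 0 L, C₁ ≤ EI t ∧ EI t ≤ C₂)
    (k : Fin N) : C₁ ≤ elementMin L EI x k ∧
      ∀ t ∈ Icc (x k.castSucc) (x k.succ), t ∈ Ioo 0 L → elementMin L EI x k ≤ EI t := by
  have hlt := hx.lt_succ k
  have h1 := hx.mem_Icc k.castSucc
  have h2 := hx.mem_Icc k.succ
  have hlow : ∀ y ∈ EI '' (Icc (x k.castSucc) (x k.succ) ∩ Ioo 0 L), C₁ ≤ y := by
    rintro _ ⟨t, ht, rfl⟩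
    exact (hEI t ht.2).1
  constructor
  · refine le_csInf ?_ hlow
    refine ⟨_, mem_image_of_mem EI (x := (x k.castSucc + x k.succ) / 2) ⟨⟨?_, ?_⟩, ?_, ?_⟩⟩ <;>
      linarith [h1.1, h2.2]
  · intro t ht ht'
    exact csInf_le ⟨C₁, hlow⟩ (mem_image_of_mem EI ⟨ht, ht'⟩)

theorem auxStiffness_eq (hx : IsPartition L x) {t : ℝ} {k : Fin N}
    (ht : t ∈ Ico (x k.castSucc) (x k.succ)) : auxStiffness L EI x t = elementMin L EI x k :=
  hx.sum_indicator (fun k _ => elementMin L EI x k) ht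

theorem auxStiffness_le (hx : IsPartition L x) (hEI : ∀ t ∈ Ioo 0 L, C₁ ≤ EI t ∧ EI t ≤ C₂)
    {t : ℝ} (ht : t ∈ Ioo 0 L) : auxStiffness L EI x t ≤ EI t := by
  obtain ⟨k, hk⟩ := hx.exists_mem_Ico (Ioo_subset_Ico_self ht)
  rw [auxStiffness_eq hx hk]
  exact (elementMin_bounds hx hEI k).2 t (Ico_subset_Icc_self hk) ht

theorem isStiffness_auxStiffness (hx : IsPartition L x) (hC₁ : 0 < C₁)
    (hEI : ∀ t ∈ Ioo 0 L, C₁ ≤ EI t ∧ EI t ≤ C₂) :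
    IsStiffness L (auxStiffness L EI x) C₁ C₂ where
  aemeasurable := by
    refine Measurable.aemeasurable ?_
    unfold auxStiffness
    exact Finset.measurable_sum _ fun k _ => measurable_const.indicator measurableSet_Ico
  pos := hC₁
  le t ht := by
    obtain ⟨k, hk⟩ := hx.exists_mem_Ico (Ioo_subset_Ico_self ht)
    rw [auxStiffness_eq hx hk]
    exact (elementMin_bounds hx hEI k).1
  ge t ht := (auxStiffness_le hx hEI ht).trans (hEI t ht).2

theorem IsStiffness.inner_sqrtMul_auxStiffness (hL : 0 < L) (hx : IsPartition L x) {c C : ℝ}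
    (h : IsStiffness L (auxStiffness L EI x) c C) (f g : L2 L) :
    inner ℝ (h.sqrtMul f) (h.sqrtMul g) =
      ∑ k : Fin N, elementMin L EI x k * ∫ t in x k.castSucc..x k.succ, f t * g t := by
  have hi : IntervalIntegrable (fun t => auxStiffness L EI x t * f t * g t) volume 0 L := by
    rw [intervalIntegrable_iff_integrableOn_Ioc_of_le hL.le, IntegrableOn, ← restrict_Ioo_eq_Ioc]
    exact h.integrable f g
  rw [h.inner_sqrtMul, integral_Ioo_eq hL.le, ← hx.sum_integral hi]
  refine Finset.sum_congr rfl fun k _ => ?_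
  rw [← intervalIntegral.integral_const_mul]
  refine intervalIntegral.integral_congr_ae ?_
  filter_upwards [Measure.ae_ne volume (x k.succ)] with t h1 h2
  rw [uIoc_of_le (hx.lt_succ k).le] at h2
  rw [auxStiffness_eq hx (k := k) ⟨h2.1.le, lt_of_le_of_ne h2.2 h1⟩, mul_assoc]

/-- This is h_k² ≤ h_EI² κ_k, divided by (2π)², in the form required by
`OrthAffine.integral_sq_prim_le`. -/
theorem sq_div_le_interpConst (hx : IsPartition L x) (hC₁ : 0 < C₁)
    (hEI : ∀ t ∈ Ioo 0 L, C₁ ≤ EI t ∧ EI t ≤ C₂) (k : Fin N) :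
    ((x k.succ - x k.castSucc) / (2 * Real.pi)) ^ 2 ≤
      interpConst L EI x ^ 2 * elementMin L EI x k := by
  have hκ : ∀ j, 0 < elementMin L EI x j := fun j =>
    hC₁.trans_le (elementMin_bounds hx hEI j).1
  have h1 : (x k.succ - x k.castSucc) ^ 2 / elementMin L EI x k ≤
      ⨆ j : Fin N, (x j.succ - x j.castSucc) ^ 2 / elementMin L EI x j :=
    le_ciSup (f := fun j : Fin N => (x j.succ - x j.castSucc) ^ 2 / elementMin L EI x j)
      (finite_range _).bddAbove k
  rw [div_le_iff₀ (hκ k)] at h1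
  rw [interpConst, scaledMeshSize, div_pow, div_pow, Real.sq_sqrt (Real.iSup_nonneg fun j =>
    div_nonneg (sq_nonneg _) (hκ j).le), div_mul_eq_mul_div]
  exact div_le_div_of_nonneg_right h1 (sq_nonneg _)

/-- The Hermite interpolation operator: `u''` is replaced by its piecewise affine projection. -/
theorem exists_interpolation (hL : 0 < L) (hx : IsPartition L x) :
    ∃ I : H20 L →ₗ[ℝ] H20 L, ∀ u, (I u : L2 L) ∈ hermiteSpace L x ∧
      derivTwoH20 L (I u) ∈ piecewisePoly L x 2 ∧ OrthAffine x (derivTwoH20 L (u - I u)) := by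
  have := finiteDimensional_piecewisePoly hx 2
  let pr := (piecewisePoly L x 2).starProjection
  have horth : ∀ g, OrthAffine x (g - pr g) := fun g =>
    orthAffine_of_mem_orthogonal hx (Submodule.sub_starProjection_mem_orthogonal _)
  -- The boundary conditions at `L` pass from g to its projection because both functionals vanish on
  -- the residual g - pr g.
  have hmem : ∀ u : H20 L, ((primL L ∘L primL L ∘L pr : L2 L →L[ℝ] L2 L) : L2 L →ₗ[ℝ] L2 L)
      (derivTwoH20 L u) ∈ H20 L := by
    intro u
    obtain ⟨-, -, h3, h4⟩ := derivTwoH20_spec hL u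
    set g := derivTwoH20 L u
    refine (mem_H20_iff hL).2 ⟨pr g, ?_, ?_, rfl⟩
    · have h5 := (horth g).prim_eq_zero hx (Fin.last N)
      rw [hx.last, ← primEnd_apply hL.le, map_sub, primEnd_apply, primEnd_apply, h3, zero_sub,
        neg_eq_zero] at h5
      exact h5
    · have h5 := (horth g).prim_primL_eq_zero hx
      rw [← primEnd_apply hL.le, map_sub, map_sub, primEnd_apply, primEnd_apply, h4, zero_sub,
        neg_eq_zero] at h5
      exact h5
  let I : H20 L →ₗ[ℝ] H20 L := LinearMap.codRestrict (H20 L)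
    (((primL L ∘L primL L ∘L pr : L2 L →L[ℝ] L2 L) : L2 L →ₗ[ℝ] L2 L) ∘ₗ derivTwoH20 L) hmem
  have hI : ∀ u, (I u : L2 L) = primL L (primL L (pr (derivTwoH20 L u))) := fun _ => rfl
  have hI2 : ∀ u, derivTwoH20 L (I u) = pr (derivTwoH20 L u) := fun u => by
    rw [derivTwoH20_apply, hI, weakDeriv_primL hL, weakDeriv_primL hL]
  have hprm : ∀ g, pr g ∈ piecewisePoly L x 2 := fun g => Submodule.starProjection_apply_mem _ g
  refine ⟨I, fun u => ⟨mem_hermiteSpace_iff.2 ⟨(I u).2, ?_⟩, ?_, ?_⟩⟩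
  · rw [hI]
    exact primL_mem_piecewisePoly hx (primL_mem_piecewisePoly hx (hprm _))
  · rw [hI2]
    exact hprm _
  · rw [map_sub, hI2]
    exact horth _

end Mesh

end BeamBuckling
end

/-! ### The two-sided eigenvalue bounds -/

open BeamBuckling

theorem mainTheorem1 (L : ℝ) (hL : 0 < L) (EI : ℝ → ℝ)
    (hmeas : AEMeasurable EI (volume.restrict (Ioo 0 L)))
    (C₁ C₂ : ℝ) (hC₁ : 0 < C₁) (hEI : ∀ t ∈ Ioo 0 L, C₁ ≤ EI t ∧ EI t ≤ C₂)
    (N : ℕ) (x : Fin (N + 1) → ℝ) (hx : BeamBuckling.IsPartition L x) :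
    FiniteDimensional ℝ (BeamBuckling.hermiteSpace L x) ∧
    (∃ P : ℕ → ℝ, BeamBuckling.IsEigenvalueEnumeration L EI (BeamBuckling.H20 L) P) ∧
    (∃ Ph : Fin (Module.finrank ℝ (BeamBuckling.hermiteSpace L x)) → ℝ,
      BeamBuckling.IsEigenvalueEnumeration L EI (BeamBuckling.hermiteSpace L x) Ph) ∧
    (∃ Pt : Fin (Module.finrank ℝ (BeamBuckling.hermiteSpace L x)) → ℝ,
      BeamBuckling.IsEigenvalueEnumeration L (BeamBuckling.auxStiffness L EI x)
        (BeamBuckling.hermiteSpace L x) Pt) ∧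
    ∀ (P : ℕ → ℝ) (Ph Pt : Fin (Module.finrank ℝ (BeamBuckling.hermiteSpace L x)) → ℝ),
      BeamBuckling.IsEigenvalueEnumeration L EI (BeamBuckling.H20 L) P →
      BeamBuckling.IsEigenvalueEnumeration L EI (BeamBuckling.hermiteSpace L x) Ph →
      BeamBuckling.IsEigenvalueEnumeration L (BeamBuckling.auxStiffness L EI x)
        (BeamBuckling.hermiteSpace L x) Pt →
      ∀ i : Fin (Module.finrank ℝ (BeamBuckling.hermiteSpace L x)),
        Pt i / (1 + Pt i * BeamBuckling.interpConst L EI x ^ 2) ≤ P i ∧ P i ≤ Ph i := by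
  have hfin := finiteDimensional_hermiteSpace hx
  have hle : hermiteSpace L x ≤ H20 L := fun _ hv => hv.1
  have hS : IsStiffness L EI C₁ C₂ :=
    ⟨hmeas, hC₁, fun t ht => (hEI t ht).1, fun t ht => (hEI t ht).2⟩
  have hT := isStiffness_auxStiffness hx hC₁ hEI
  obtain ⟨p, e, hp⟩ := hS.exists_isEigensystem_H20 hL
  obtain ⟨q, f, hq⟩ := hS.exists_isEigensystem_fin hL hle
  obtain ⟨r, g, hr⟩ := hT.exists_isEigensystem_fin hL hle
  have hpE : IsEigenvalueEnumeration L EI (H20 L) p := by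
    refine IsEigensystem.isEigenvalueEnumeration hS le_rfl (e := e) ?_
    rw [Submodule.comap_subtype_self]
    exact hp
  have hqE := IsEigensystem.isEigenvalueEnumeration hS hle hq
  have hrE := IsEigensystem.isEigenvalueEnumeration hT hle hr
  refine ⟨hfin, ⟨p, hpE⟩, ⟨q, hqE⟩, ⟨r, hrE⟩, fun P Ph Pt hP hPh hPt i => ?_⟩
  -- Uniqueness replaces the arbitrary enumerations by the constructed ones, which come with
  -- eigenvectors.
  obtain rfl := eq_of_card_fibre_eq hP.1 hpE.1 fun μ => (hP.2 μ).trans (hpE.2 μ).symm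
  obtain rfl := eq_of_card_fibre_eq hPh.1 hqE.1 fun μ => (hPh.2 μ).trans (hqE.2 μ).symm
  obtain rfl := eq_of_card_fibre_eq hPt.1 hrE.1 fun μ => (hPt.2 μ).trans (hrE.2 μ).symm
  refine ⟨?_, hp.le_of_le hq le_top i⟩
  obtain ⟨I, hI⟩ := exists_interpolation hL hx
  refine hp.div_le_of_projection hr (pr := I) (fun u => (hI u).1) ?_ ?_ ?_ i
  · intro u
    rw [← real_inner_self_eq_norm_sq, ← real_inner_self_eq_norm_sq, hS.energyMap_apply,
      hT.energyMap_apply, hS.inner_sqrtMul, hT.inner_sqrtMul]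
    refine setIntegral_mono_on (hT.integrable _ _) (hS.integrable _ _) measurableSet_Ioo
      fun t ht => ?_
    rw [mul_assoc, mul_assoc]
    exact mul_le_mul_of_nonneg_right (auxStiffness_le hx hEI ht) (mul_self_nonneg _)
  · intro u
    -- Since κ is constant on each element, it factors out of the elementwise integrals of (I u)''
    -- (u - I u)'', and these vanish.
    have h0 : inner ℝ (hT.energyMap (I u)) (hT.energyMap (u - I u)) = 0 := by
      rw [hT.energyMap_apply, hT.energyMap_apply, hT.inner_sqrtMul_auxStiffness hL hx]
      refine Finset.sum_eq_zero fun k _ => ?_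
      rw [(hI u).2.2.integral_mul_eq_zero hx (hI u).2.1 k, mul_zero]
    have h1 : hT.energyMap u = hT.energyMap (I u) + hT.energyMap (u - I u) := by
      rw [← map_add, add_sub_cancel]
    rw [h1, norm_add_sq_real, h0]
    ring
  · intro u
    have h1 := (hI u).2.2.integral_sq_prim_le hx (sq_div_le_interpConst hx hC₁ hEI)
    have h2 := hT.inner_sqrtMul_auxStiffness hL hx (derivTwoH20 L (u - I u))
      (derivTwoH20 L (u - I u))
    simp_rw [← sq] at h2
    rw [← h2, ← norm_sq_primL hL.le, real_inner_self_eq_norm_sq, ← mul_pow,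
      ← (derivTwoH20_spec hL _).1] at h1
    have hC : 0 ≤ interpConst L EI x := by
      unfold interpConst scaledMeshSize
      positivity
    exact (sq_le_sq₀ (norm_nonneg _) (mul_nonneg hC (norm_nonneg _))).1 h1
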